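/- **Setting.** For a sequence of number pairs $D=((h_1,s_1),\dots,(h_n,s_n))$ with real entries and an index interval $[i,j]$, $1\le i\le j\le n$, put $hit(i,j)=\sum_{k=i}^j h_k$, $sup(i,j)=\sum_{k=i}^j s_k$, $ecc(i,j)=hit(i,j)/\sqrt{sup(i,j)}$ and $length(i,j)=j-i+1$. The sequence is *plain* if $s_k=1$ for all $k$. The *PSEI problem*: given a plain sequence $D$ of $n$ pairs and an integer $L$ with $1\le L\le n$, find an index interval $[i,j]$ that maximizes $ecc(i,j)$ subject to $sup(i,j)=length(i,j)\ge L$. The *min-plus product* of real $d\times d$ matrices $(b_{ij})$ and $(c_{ij})$ is the matrix with entries $\min_k(b_{ik}+c_{kj})$. **Algorithm ComputePSEI** (ties in an $\arg\max$ are broken arbitrarily). 1. Let $(i,j)=\arg\max_{length(p,q)\ge L} hit(p,q)$. 2. If $hit(i,j)=0$, return $[i,j]$. 3. If $hit(i,j)>0$, return an interval of length at least $L$ that maximizes $f(length(p,q),hit(p,q))$, where $f(\ell,h)=h/\sqrt{\ell}$ if $h\ge 0$ and $f(\ell,h)=0$ otherwise. 4. If $hit(i,j)<0$, let $N=\max\{1,\lceil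 n/(2L)\rceil-1\}$, and for $k=0,\dots,N-1$ let $I_k$ be the window $[2kL+1,\ \min\{n,2kL+4L\}]$. (If $4L$ divides $n$, then $N=\frac{n}{2L}-1$ and every window has length $4L$.) For each $k$, let $w_j$ be the maximum of $hit(p,q)$ over the intervals $[p,q]\subseteq I_k$ of length $j$; let $j_k$ be a $j$ that maximizes $w_j/\sqrt{j}$ among the integers $L\le j\le 2L-1$ with $j\le |I_k|$; and let $i_k$ be an $i$ that maximizes $ecc(i,i+j_k-1)$ among those with $[i,i+j_k-1]\subseteq I_k$. Return an interval of maximum eccentricity among the $[i_k,i_k+j_k-1]$. Running times are measured on a real RAM: real numbers can be added, subtracted, multiplied, divided, rooted and compared, natural numbers can be added, subtracted and compared and converted to reals, there are arrays of both kinds indexed by natural numbers, and each operation and memory access takes one time unit. Memory that does not hold the input is initially arbitrary. **Theorem.** Algorithm ComputePSEI solves the PSEI problem in $O\!\left(n\,\frac{T(L^{1/2})}{L^{1/2}}\right)$ time, where $T(d)$ is the time required to compute the min-plus product of two $d\times d$ matrices. Precisely: * For every plain sequence $D$ of $n$ pairs and every integer $1\le L\le n$, every interval that ComputePSEI may return is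 a solution of the PSEI problem. * There is a constant $K$ such that the following holds for every function $T$ and every program $M$ that, for each $d\ge 1$, computes the min-plus product of any two real $d\times d$ matrices in time at most $T(d)$. There is a program $P$ that, for every plain sequence $D$ of $n$ pairs and every integer $1\le L\le n$, given $n$, $L$ and $D$, halts after at most $K\cdot n\cdot T(\lceil\sqrt L\,\rceil)/\sqrt L$ time units with an interval that ComputePSEI may return. -/

import Mathlib

/-! ### A real RAM with unit costs

Programs are written in a small imperative language over finitely many named registers and arrays.
There are registers and (unbounded) arrays of natural numbers, used for counters, indices and
pointers, and registers and arrays of real numbers. Natural numbers can be added, subtracted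
(truncated at `0`) and compared; real numbers can be added, subtracted, multiplied, divided, rooted
and compared; a natural number can be converted into a real number, but not conversely. Every
constant, register access, array access, arithmetic operation, comparison, Boolean connective,
assignment, and evaluated test of a conditional or of a loop takes one time unit. -/

namespace RealRAM

/-- A memory state: integer registers, real registers, integer arrays, real arrays. -/
structure State where
  nat : ℕ → ℕ
  real : ℕ → ℝ
  natArr : ℕ → ℕ → ℕ
  realArr : ℕ → ℕ → ℝ

/-- Expressions for natural numbers. -/
inductive NExpr where
  | const (c : ℕ)
  | reg (x : ℕ)
  | get (a : ℕ) (e : NExpr)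
  | add (e₁ e₂ : NExpr)
  | sub (e₁ e₂ : NExpr)

/-- Expressions for real numbers. -/
inductive RExpr where
  | ofNat (e : NExpr)
  | reg (x : ℕ)
  | get (a : ℕ) (e : NExpr)
  | add (e₁ e₂ : RExpr)
  | sub (e₁ e₂ : RExpr)
  | mul (e₁ e₂ : RExpr)
  | div (e₁ e₂ : RExpr)
  | sqrt (e : RExpr)

/-- Tests. -/
inductive BExpr where
  | natLe (e₁ e₂ : NExpr)
  | realLe (e₁ e₂ : RExpr)
  | not (b : BExpr)
  | and (b₁ b₂ : BExpr)

/-- Programs. -/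
inductive Prog where
  | skip
  | setNat (x : ℕ) (e : NExpr)
  | setReal (x : ℕ) (e : RExpr)
  | storeNat (a : ℕ) (i : NExpr) (e : NExpr)
  | storeReal (a : ℕ) (i : NExpr) (e : RExpr)
  | seq (p q : Prog)
  | ite (b : BExpr) (p q : Prog)
  | while (b : BExpr) (p : Prog)

namespace NExpr

def eval (σ : State) : NExpr → ℕ
  | const c => c
  | reg x => σ.nat x
  | get a e => σ.natArr a (e.eval σ)
  | add e₁ e₂ => e₁.eval σ + e₂.eval σ
  | sub e₁ e₂ => e₁.eval σ - e₂.eval σ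

def cost : NExpr → ℕ
  | const _ => 1
  | reg _ => 1
  | get _ e => e.cost + 1
  | add e₁ e₂ => e₁.cost + e₂.cost + 1
  | sub e₁ e₂ => e₁.cost + e₂.cost + 1

end NExpr

namespace RExpr

noncomputable def eval (σ : State) : RExpr → ℝ
  | ofNat e => (e.eval σ : ℝ)
  | reg x => σ.real x
  | get a e => σ.realArr a (e.eval σ)
  | add e₁ e₂ => e₁.eval σ + e₂.eval σ
  | sub e₁ e₂ => e₁.eval σ - e₂.eval σ
  | mul e₁ e₂ => e₁.eval σ * e₂.eval σ
  | div e₁ e₂ => e₁.eval σ / e₂.eval σ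
  | sqrt e => Real.sqrt (e.eval σ)

def cost : RExpr → ℕ
  | ofNat e => e.cost + 1
  | reg _ => 1
  | get _ e => e.cost + 1
  | add e₁ e₂ => e₁.cost + e₂.cost + 1
  | sub e₁ e₂ => e₁.cost + e₂.cost + 1
  | mul e₁ e₂ => e₁.cost + e₂.cost + 1
  | div e₁ e₂ => e₁.cost + e₂.cost + 1
  | sqrt e => e.cost + 1

end RExpr

namespace BExpr

/-- The test `b` succeeds in the state `σ`. -/
def holds (σ : State) : BExpr → Prop
  | natLe e₁ e₂ => e₁.eval σ ≤ e₂.eval σ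
  | realLe e₁ e₂ => e₁.eval σ ≤ e₂.eval σ
  | not b => ¬ b.holds σ
  | and b₁ b₂ => b₁.holds σ ∧ b₂.holds σ

def cost : BExpr → ℕ
  | natLe e₁ e₂ => e₁.cost + e₂.cost + 1
  | realLe e₁ e₂ => e₁.cost + e₂.cost + 1
  | not b => b.cost + 1
  | and b₁ b₂ => b₁.cost + b₂.cost + 1

end BExpr

namespace State

def setNat (σ : State) (x v : ℕ) : State :=
  { σ with nat := Function.update σ.nat x v }

def setReal (σ : State) (x : ℕ) (v : ℝ) : State :=
  { σ with real := Function.update σ.real x v }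

def storeNat (σ : State) (a i v : ℕ) : State :=
  { σ with natArr := Function.update σ.natArr a (Function.update (σ.natArr a) i v) }

def storeReal (σ : State) (a i : ℕ) (v : ℝ) : State :=
  { σ with realArr := Function.update σ.realArr a (Function.update (σ.realArr a) i v) }

end State

/-- `Run p σ t σ'`: started in the state `σ`, the program `p` halts after `t` time units in the
state `σ'`. -/
inductive Run : Prog → State → ℕ → State → Prop
  | skip (σ : State) : Run .skip σ 1 σ
  | setNat (σ : State) (x : ℕ) (e : NExpr) :
      Run (.setNat x e) σ (e.cost + 1) (σ.setNat x (e.eval σ))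
  | setReal (σ : State) (x : ℕ) (e : RExpr) :
      Run (.setReal x e) σ (e.cost + 1) (σ.setReal x (e.eval σ))
  | storeNat (σ : State) (a : ℕ) (i e : NExpr) :
      Run (.storeNat a i e) σ (i.cost + e.cost + 1) (σ.storeNat a (i.eval σ) (e.eval σ))
  | storeReal (σ : State) (a : ℕ) (i : NExpr) (e : RExpr) :
      Run (.storeReal a i e) σ (i.cost + e.cost + 1) (σ.storeReal a (i.eval σ) (e.eval σ))
  | seq {p q : Prog} {σ σ₁ σ₂ : State} {t₁ t₂ : ℕ} :
      Run p σ t₁ σ₁ → Run q σ₁ t₂ σ₂ → Run (.seq p q) σ (t₁ + t₂) σ₂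
  | iteTrue {b : BExpr} {p q : Prog} {σ σ₁ : State} {t : ℕ} :
      b.holds σ → Run p σ t σ₁ → Run (.ite b p q) σ (b.cost + t + 1) σ₁
  | iteFalse {b : BExpr} {p q : Prog} {σ σ₁ : State} {t : ℕ} :
      ¬ b.holds σ → Run q σ t σ₁ → Run (.ite b p q) σ (b.cost + t + 1) σ₁
  | whileFalse {b : BExpr} {p : Prog} {σ : State} :
      ¬ b.holds σ → Run (.while b p) σ (b.cost + 1) σ
  | whileTrue {b : BExpr} {p : Prog} {σ σ₁ σ₂ : State} {t₁ t₂ : ℕ} :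
      b.holds σ → Run p σ t₁ σ₁ → Run (.while b p) σ₁ t₂ σ₂ →
        Run (.while b p) σ (b.cost + t₁ + t₂ + 1) σ₂

end RealRAM

/-! ### Min-plus products -/

/-- The min-plus product of two real matrices: the `(i, j)` entry is `min_k (b_{ik} + c_{kj})`. (The
infimum over `k` is a minimum whenever the inner index type is finite and nonempty.) -/
noncomputable def minPlusProduct {l m n : Type*} (B : Matrix l m ℝ) (C : Matrix m n ℝ) :
    Matrix l n ℝ :=
  fun i j => ⨅ k, (B i k + C k j)

/-- `M` computes the min-plus product of any two real `d × d` matrices in time at most `T d`, for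
every `d ≥ 1`. Input: `d` in integer register `0`, the two matrices row by row in the real arrays
`0` and `1`. Output: the product, row by row, in the real array `2`. The rest of the memory is
uninitialised, that is, arbitrary. -/
def ComputesMinPlusProduct (M : RealRAM.Prog) (T : ℕ → ℝ) : Prop :=
  ∀ (d : ℕ), 1 ≤ d → ∀ (B C : Matrix (Fin d) (Fin d) ℝ) (σ : RealRAM.State),
    σ.nat 0 = d →
    (∀ i j : Fin d, σ.realArr 0 (i.val * d + j.val) = B i j) →
    (∀ i j : Fin d, σ.realArr 1 (i.val * d + j.val) = C i j) →
    ∃ (t : ℕ) (σ' : RealRAM.State), RealRAM.Run M σ t σ' ∧ (t : ℝ) ≤ T d ∧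
      ∀ i j : Fin d, σ'.realArr 2 (i.val * d + j.val) = minPlusProduct B C i j

/-! ### The optimization problem

A sequence of `n` number pairs `(h_1, s_1), …, (h_n, s_n)` is given by `D : ℕ → ℝ × ℝ` with
`D k = (h_k, s_k)` for `1 ≤ k ≤ n`; the other values of `D` play no role. A pair `I : ℕ × ℕ` stands
for the index interval `[I.1, I.2]`. -/

namespace PSEI

/-- The sequence is plain: `s_k = 1` for `1 ≤ k ≤ n`. -/
def Plain (n : ℕ) (D : ℕ → ℝ × ℝ) : Prop :=
  ∀ k, 1 ≤ k → k ≤ n → (D k).2 = 1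

/-- The hit-support. -/
noncomputable def hit (D : ℕ → ℝ × ℝ) (I : ℕ × ℕ) : ℝ := ∑ k ∈ Finset.Icc I.1 I.2, (D k).1

/-- The support. -/
noncomputable def supp (D : ℕ → ℝ × ℝ) (I : ℕ × ℕ) : ℝ := ∑ k ∈ Finset.Icc I.1 I.2, (D k).2

/-- The eccentricity. -/
noncomputable def ecc (D : ℕ → ℝ × ℝ) (I : ℕ × ℕ) : ℝ := hit D I / Real.sqrt (supp D I)

/-- The length `j - i + 1` of `[i, j]` (for `i ≤ j`). -/
def length (I : ℕ × ℕ) : ℕ := I.2 + 1 - I.1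

/-- The nonempty index intervals `[i, j] ⊆ [a, b]`. -/
def intervals (a b : ℕ) : Set (ℕ × ℕ) := {I | a ≤ I.1 ∧ I.1 ≤ I.2 ∧ I.2 ≤ b}

/-- `I` solves the problem: it maximizes the eccentricity among the index intervals with support at
least `L`. -/
def IsSolution (n L : ℕ) (D : ℕ → ℝ × ℝ) (I : ℕ × ℕ) : Prop :=
  (I ∈ intervals 1 n ∧ (L : ℝ) ≤ supp D I) ∧
    ∀ J ∈ intervals 1 n, (L : ℝ) ≤ supp D J → ecc D J ≤ ecc D I

/-! ### The algorithm -/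

/-- `a` is one of the possible values of `argmax_{x ∈ S} f x`. -/
def IsArgmax {α : Type*} (f : α → ℝ) (S : Set α) (a : α) : Prop :=
  a ∈ S ∧ ∀ x ∈ S, f x ≤ f a

/-- The index intervals of length at least `L`. -/
def longIntervals (n L : ℕ) : Set (ℕ × ℕ) := {I | I ∈ intervals 1 n ∧ L ≤ length I}

/-- The score function `f(ℓ, h) = h / √ℓ` if `h ≥ 0`, and `0` otherwise. -/
noncomputable def score (l h : ℝ) : ℝ := if 0 ≤ h then h / Real.sqrt l else 0

/-- The number of windows: `max(1, ⌈n / (2L)⌉ - 1)`, which is `n / (2L) - 1` if `4L` divides `n`. -/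
def numWindows (n L : ℕ) : ℕ := max 1 ((n + 2 * L - 1) / (2 * L) - 1)

/-- The last index of the window `[2kL + 1, 2kL + 4L]`, cut off at `n`. -/
def windowEnd (n L k : ℕ) : ℕ := min n (2 * k * L + 4 * L)

/-- The index intervals of length `j` in the `k`-th window. -/
def windowIntervals (n L k j : ℕ) : Set (ℕ × ℕ) :=
  {I | I ∈ intervals (2 * k * L + 1) (windowEnd n L k) ∧ length I = j}

/-- The lengths `j` with `L ≤ j ≤ 2L - 1` that occur in the `k`-th window. -/
def windowLengths (n L k : ℕ) : Set ℕ :=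
  {j | L ≤ j ∧ j < 2 * L ∧ 2 * k * L + j ≤ windowEnd n L k}

/-- The largest hit-support `w_j` of an index interval of length `j` in the `k`-th window. -/
noncomputable def maxHit (n L : ℕ) (D : ℕ → ℝ × ℝ) (k j : ℕ) : ℝ :=
  sSup (hit D '' windowIntervals n L k j)

/-- `ComputePSEI n L D I`: with the input `D`, `L`, and a suitable resolution of the ties in its
argmax steps, the algorithm returns `[I.1, I.2]`. -/
inductive ComputePSEI (n L : ℕ) (D : ℕ → ℝ × ℝ) : ℕ × ℕ → Prop
  /-- The largest hit-support is zero: return an interval attaining it. -/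
  | zero (I : ℕ × ℕ) (hI : IsArgmax (hit D) (longIntervals n L) I) (h0 : hit D I = 0) :
      ComputePSEI n L D I
  /-- The largest hit-support is positive: return an interval with the largest score. -/
  | pos (I J : ℕ × ℕ) (hI : IsArgmax (hit D) (longIntervals n L) I) (h0 : 0 < hit D I)
      (hJ : IsArgmax (fun J => score (length J) (hit D J)) (longIntervals n L) J) :
      ComputePSEI n L D J
  /-- The largest hit-support is negative: in each window `k` choose a length `len k` and then a
  start `start k`, and return the best of the intervals so chosen. -/
  | neg (I : ℕ × ℕ) (hI : IsArgmax (hit D) (longIntervals n L) I) (h0 : hit D I < 0)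
      (len start : ℕ → ℕ)
      (hlen : ∀ k < numWindows n L,
        IsArgmax (fun j => maxHit n L D k j / Real.sqrt j) (windowLengths n L k) (len k))
      (hstart : ∀ k < numWindows n L,
        IsArgmax (fun i => ecc D (i, i + len k - 1))
          {i | (i, i + len k - 1) ∈ windowIntervals n L k (len k)} (start k))
      (k : ℕ)
      (hk : IsArgmax (fun k => ecc D (start k, start k + len k - 1))
        {k | k < numWindows n L} k) :
      ComputePSEI n L D (start k, start k + len k - 1)

/-- The memory `σ` holds the input: `n` and `L` in the integer registers `0` and `1`, and the
numbers `h_1, …, h_n` and `s_1, …, s_n` in the real arrays `0` and `1`. The rest of the memory is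
uninitialised, that is, arbitrary. -/
def HoldsInput (n L : ℕ) (D : ℕ → ℝ × ℝ) (σ : RealRAM.State) : Prop :=
  σ.nat 0 = n ∧ σ.nat 1 = L ∧
    ∀ k, 1 ≤ k → k ≤ n → σ.realArr 0 k = (D k).1 ∧ σ.realArr 1 k = (D k).2

end PSEI

/-!
**Correctness.** If the largest hit-support is zero or positive, the chosen interval is optimal by
definition of the score. If all hit-supports are negative, an interval of length at least `2L` can
be cut into two intervals of length at least `L`, one of which is no worse, because
`√a + √b ≥ √(a + b)` (`PSEI.exists_short`). So an optimal interval is to be found among the lengths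
from `L` to `2L - 1`, and each interval of such a length lies in one of the overlapping windows
(`PSEI.exists_window`). Conversely, in this case the algorithm may return every optimal interval of
length less than `2L` (`PSEI.ComputePSEI.of_isArgmax_ecc`), so a program may look for one in any
way.

**Running time.** With the prefix sums `P`, the task is to maximize `(P j - P i) / √(j - i)` subject
to `i + L ≤ j`. The interval of largest hit-support is found in linear time by a running minimum.

If it is positive, linear time suffices as well. By strict concavity of the square root, an optimal
pair `(i, j)` maximizes the linear function `P j - P i - s (j - i)` for some slope `s > 0`, and all
maximizers are optimal (`PSEI.exists_critical`). For `j = L, …, n` the program maintains the lower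
convex hull of the points `(i, P i)` with `i ≤ j - L`, on a stack. An end `j` is of interest only
for slopes that are at least the largest slope `r` of a chord from `j` to a later point; the starts
`i` that are hull vertices for such slopes only need not be considered with later ends, as `j` is
a better end for them. So they can be popped once they have been tried with `j`, and the total time
is linear (`PSEI.scanHulls_spec`). The numbers `r` come from a similar scan of the upper convex
hulls, from right to left (`PSEI.rightSlopes_spec`).

If all hit-supports are negative, let `d = ⌈√L⌉`. For a block of `d ^ 2` starts from `s` on and an
offset `g`, consider the `d × d` matrices with the entries `P (s + x d + y)` in position `(x, y)` and
`-P (s + g + r + y)` in position `(y, r)`. The entry `(x, r)` of their min-plus product is the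
negative of the largest hit-support among `d` intervals of the same length `g + r - x d`. When `g`
runs through `O(d)` multiples of `d`, all intervals of lengths between `L` and `2L - 1` that start in
the block occur (`PSEI.processBlocks_spec`). This takes `O(d)` products for each of `O(n / L)`
blocks, and everything else is dominated by `T d`, since `T d ≥ d ^ 2`: a program for min-plus
products has to write `d ^ 2` entries (`ComputesMinPlusProduct.sq_le`).

The programs are verified by weakest preconditions, with a potential in the rule for loops that
accounts for the running time (`RealRAM.wp_while`). A given program for min-plus products is moved
to registers and arrays with names from `100` on (`RealRAM.Run.shift`), so that it does not interfere
with the names below `100`.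
-/

/-! ### Weakest preconditions for the real RAM -/

namespace RealRAM

namespace State

variable (σ : State) (a a' i j x y : ℕ) (v : ℕ) (w : ℝ)

@[simp] theorem nat_setNat : (σ.setNat x v).nat y = if y = x then v else σ.nat y :=
  Function.update_apply ..

@[simp] theorem real_setNat : (σ.setNat x v).real = σ.real := rfl

@[simp] theorem natArr_setNat : (σ.setNat x v).natArr = σ.natArr := rfl

@[simp] theorem realArr_setNat : (σ.setNat x v).realArr = σ.realArr := rfl

@[simp] theorem nat_setReal : (σ.setReal x w).nat = σ.nat := rfl

@[simp] theorem real_setReal : (σ.setReal x w).real y = if y = x then w else σ.real y :=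
  Function.update_apply ..

@[simp] theorem natArr_setReal : (σ.setReal x w).natArr = σ.natArr := rfl

@[simp] theorem realArr_setReal : (σ.setReal x w).realArr = σ.realArr := rfl

@[simp] theorem nat_storeNat : (σ.storeNat a i v).nat = σ.nat := rfl

@[simp] theorem real_storeNat : (σ.storeNat a i v).real = σ.real := rfl

@[simp] theorem natArr_storeNat :
    (σ.storeNat a i v).natArr a' j = if a' = a ∧ j = i then v else σ.natArr a' j := by
  by_cases h : a' = a
  · subst h; simp [storeNat, Function.update_apply]
  · simp [storeNat, h]

@[simp] theorem realArr_storeNat : (σ.storeNat a i v).realArr = σ.realArr := rfl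

@[simp] theorem nat_storeReal : (σ.storeReal a i w).nat = σ.nat := rfl

@[simp] theorem real_storeReal : (σ.storeReal a i w).real = σ.real := rfl

@[simp] theorem natArr_storeReal : (σ.storeReal a i w).natArr = σ.natArr := rfl

@[simp] theorem realArr_storeReal :
    (σ.storeReal a i w).realArr a' j = if a' = a ∧ j = i then w else σ.realArr a' j := by
  by_cases h : a' = a
  · subst h; simp [storeReal, Function.update_apply]
  · simp [storeReal, h]

end State

/-- `Wp p Q σ`: started in the state `σ`, the program `p` halts, and the running time `t` and the
final state `σ'` satisfy `Q t σ'`. -/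
def Wp (p : Prog) (Q : ℕ → State → Prop) (σ : State) : Prop :=
  ∃ (t : ℕ) (σ' : State), Run p σ t σ' ∧ Q t σ'

section Rules

variable {p q : Prog} {b : BExpr} {Q Q' : ℕ → State → Prop} {σ : State}

theorem Wp.mono (h : Wp p Q σ) (hQ : ∀ t σ', Q t σ' → Q' t σ') : Wp p Q' σ := by
  obtain ⟨t, σ', hr, hq⟩ := h
  exact ⟨t, σ', hr, hQ _ _ hq⟩

theorem wp_skip : Wp .skip Q σ ↔ Q 1 σ :=
  ⟨fun ⟨_, _, h, hq⟩ => by cases h; exact hq, fun h => ⟨_, _, .skip σ, h⟩⟩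

theorem wp_setNat {x : ℕ} {e : NExpr} :
    Wp (.setNat x e) Q σ ↔ Q (e.cost + 1) (σ.setNat x (e.eval σ)) :=
  ⟨fun ⟨_, _, h, hq⟩ => by cases h; exact hq, fun h => ⟨_, _, .setNat σ x e, h⟩⟩

theorem wp_setReal {x : ℕ} {e : RExpr} :
    Wp (.setReal x e) Q σ ↔ Q (e.cost + 1) (σ.setReal x (e.eval σ)) :=
  ⟨fun ⟨_, _, h, hq⟩ => by cases h; exact hq, fun h => ⟨_, _, .setReal σ x e, h⟩⟩

theorem wp_storeNat {a : ℕ} {i e : NExpr} :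
    Wp (.storeNat a i e) Q σ ↔
      Q (i.cost + e.cost + 1) (σ.storeNat a (i.eval σ) (e.eval σ)) :=
  ⟨fun ⟨_, _, h, hq⟩ => by cases h; exact hq, fun h => ⟨_, _, .storeNat σ a i e, h⟩⟩

theorem wp_storeReal {a : ℕ} {i : NExpr} {e : RExpr} :
    Wp (.storeReal a i e) Q σ ↔
      Q (i.cost + e.cost + 1) (σ.storeReal a (i.eval σ) (e.eval σ)) :=
  ⟨fun ⟨_, _, h, hq⟩ => by cases h; exact hq, fun h => ⟨_, _, .storeReal σ a i e, h⟩⟩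

theorem wp_seq :
    Wp (.seq p q) Q σ ↔ Wp p (fun t σ₁ => Wp q (fun t' σ₂ => Q (t + t') σ₂) σ₁) σ := by
  constructor
  · rintro ⟨_, _, h, hq⟩
    cases h with
    | seq h₁ h₂ => exact ⟨_, _, h₁, _, _, h₂, hq⟩
  · rintro ⟨t₁, σ₁, h₁, t₂, σ₂, h₂, hq⟩
    exact ⟨_, _, .seq h₁ h₂, hq⟩

theorem wp_ite :
    Wp (.ite b p q) Q σ ↔
      (b.holds σ → Wp p (fun t σ' => Q (b.cost + t + 1) σ') σ) ∧
        (¬ b.holds σ → Wp q (fun t σ' => Q (b.cost + t + 1) σ') σ) := by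
  constructor
  · rintro ⟨_, _, h, hq⟩
    cases h with
    | iteTrue hb h => exact ⟨fun _ => ⟨_, _, h, hq⟩, fun hn => absurd hb hn⟩
    | iteFalse hb h => exact ⟨fun hn => absurd hn hb, fun _ => ⟨_, _, h, hq⟩⟩
  · rintro ⟨h₁, h₂⟩
    by_cases hb : b.holds σ
    · obtain ⟨t, σ', h, hq⟩ := h₁ hb
      exact ⟨_, _, .iteTrue hb h, hq⟩
    · obtain ⟨t, σ', h, hq⟩ := h₂ hb
      exact ⟨_, _, .iteFalse hb h, hq⟩

end Rules

/-! ### Names that a program does not write to -/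

namespace Prog

/-- Whether the program contains an assignment to the integer register `x`. -/
def writesNat (x : ℕ) : Prog → Bool
  | setNat y _ => x == y
  | seq p q => p.writesNat x || q.writesNat x
  | ite _ p q => p.writesNat x || q.writesNat x
  | .while _ p => p.writesNat x
  | _ => false

/-- Whether the program contains an assignment to the real register `x`. -/
def writesReal (x : ℕ) : Prog → Bool
  | setReal y _ => x == y
  | seq p q => p.writesReal x || q.writesReal x
  | ite _ p q => p.writesReal x || q.writesReal x
  | .while _ p => p.writesReal x
  | _ => false

/-- Whether the program contains an assignment to an entry of the integer array `a`. -/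
def writesNatArr (a : ℕ) : Prog → Bool
  | storeNat a' _ _ => a == a'
  | seq p q => p.writesNatArr a || q.writesNatArr a
  | ite _ p q => p.writesNatArr a || q.writesNatArr a
  | .while _ p => p.writesNatArr a
  | _ => false

/-- Whether the program contains an assignment to an entry of the real array `a`. -/
def writesRealArr (a : ℕ) : Prog → Bool
  | storeReal a' _ _ => a == a'
  | seq p q => p.writesRealArr a || q.writesRealArr a
  | ite _ p q => p.writesRealArr a || q.writesRealArr a
  | .while _ p => p.writesRealArr a
  | _ => false

end Prog

/-- The states `σ` and `σ'` agree on all registers and arrays that `p` has no assignment to. -/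
structure Frame (p : Prog) (σ σ' : State) : Prop where
  nat : ∀ x, p.writesNat x = false → σ'.nat x = σ.nat x
  real : ∀ x, p.writesReal x = false → σ'.real x = σ.real x
  natArr : ∀ a, p.writesNatArr a = false → σ'.natArr a = σ.natArr a
  realArr : ∀ a, p.writesRealArr a = false → σ'.realArr a = σ.realArr a

namespace Frame

variable {p q : Prog} {σ σ₁ σ₂ : State}

theorem refl (p : Prog) (σ : State) : Frame p σ σ :=
  ⟨fun _ _ => rfl, fun _ _ => rfl, fun _ _ => rfl, fun _ _ => rfl⟩

theorem trans (h : Frame p σ σ₁) (h' : Frame p σ₁ σ₂) : Frame p σ σ₂ :=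
  ⟨fun x hx => (h'.nat x hx).trans (h.nat x hx), fun x hx => (h'.real x hx).trans (h.real x hx),
    fun x hx => (h'.natArr x hx).trans (h.natArr x hx),
    fun x hx => (h'.realArr x hx).trans (h.realArr x hx)⟩

/-- A program with more assignments has a weaker frame condition. -/
theorem weaken (h : Frame p σ σ₁)
    (h₁ : ∀ x, q.writesNat x = false → p.writesNat x = false)
    (h₂ : ∀ x, q.writesReal x = false → p.writesReal x = false)
    (h₃ : ∀ x, q.writesNatArr x = false → p.writesNatArr x = false)
    (h₄ : ∀ x, q.writesRealArr x = false → p.writesRealArr x = false) : Frame q σ σ₁ :=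
  ⟨fun x hx => h.nat x (h₁ x hx), fun x hx => h.real x (h₂ x hx),
    fun x hx => h.natArr x (h₃ x hx), fun x hx => h.realArr x (h₄ x hx)⟩

end Frame

theorem Run.frame {p : Prog} {σ σ' : State} {t : ℕ} (h : Run p σ t σ') : Frame p σ σ' := by
  induction h with
  | skip σ => exact .refl _ _
  | setNat σ x e =>
    refine ⟨fun y hy => ?_, fun _ _ => rfl, fun _ _ => rfl, fun _ _ => rfl⟩
    simp only [Prog.writesNat, beq_eq_false_iff_ne] at hy
    simp [hy]
  | setReal σ x e =>
    refine ⟨fun _ _ => rfl, fun y hy => ?_, fun _ _ => rfl, fun _ _ => rfl⟩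
    simp only [Prog.writesReal, beq_eq_false_iff_ne] at hy
    simp [hy]
  | storeNat σ a i e =>
    refine ⟨fun _ _ => rfl, fun _ _ => rfl, fun y hy => ?_, fun _ _ => rfl⟩
    simp only [Prog.writesNatArr, beq_eq_false_iff_ne] at hy
    ext j
    simp [hy]
  | storeReal σ a i e =>
    refine ⟨fun _ _ => rfl, fun _ _ => rfl, fun _ _ => rfl, fun y hy => ?_⟩
    simp only [Prog.writesRealArr, beq_eq_false_iff_ne] at hy
    ext j
    simp [hy]
  | seq _ _ h₁ h₂ =>
    exact (h₁.weaken (by simp +contextual [Prog.writesNat]) (by simp +contextual [Prog.writesReal])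
      (by simp +contextual [Prog.writesNatArr]) (by simp +contextual [Prog.writesRealArr])).trans
      (h₂.weaken (by simp +contextual [Prog.writesNat]) (by simp +contextual [Prog.writesReal])
      (by simp +contextual [Prog.writesNatArr]) (by simp +contextual [Prog.writesRealArr]))
  | iteTrue _ _ h =>
    exact h.weaken (by simp +contextual [Prog.writesNat]) (by simp +contextual [Prog.writesReal])
      (by simp +contextual [Prog.writesNatArr]) (by simp +contextual [Prog.writesRealArr])
  | iteFalse _ _ h =>
    exact h.weaken (by simp +contextual [Prog.writesNat]) (by simp +contextual [Prog.writesReal])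
      (by simp +contextual [Prog.writesNatArr]) (by simp +contextual [Prog.writesRealArr])
  | whileFalse _ => exact .refl _ _
  | whileTrue _ _ _ h₁ h₂ => exact .trans ⟨h₁.nat, h₁.real, h₁.natArr, h₁.realArr⟩ h₂

theorem Wp.frame {p : Prog} {Q : ℕ → State → Prop} {σ : State} (h : Wp p Q σ) :
    Wp p (fun t σ' => Frame p σ σ' ∧ Q t σ') σ := by
  obtain ⟨t, σ', hr, hq⟩ := h
  exact ⟨t, σ', hr, hr.frame, hq⟩

/-- The rule for loops, with an invariant `I` and a potential `φ` that pays for the running time: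
each round is paid for by a decrease of the potential, which also makes the loop terminate. The
registers and arrays that the body does not assign to need not be mentioned in the invariant. -/
theorem wp_while {b : BExpr} {p : Prog} {σ₀ : State} (I : State → Prop) (φ : State → ℕ)
    (h₀ : I σ₀)
    (hstep : ∀ σ, Frame p σ₀ σ → I σ → b.holds σ →
      Wp p (fun t σ' => I σ' ∧ t + b.cost + 1 + φ σ' ≤ φ σ) σ) :
    Wp (.while b p) (fun t σ' => Frame p σ₀ σ' ∧ I σ' ∧ ¬ b.holds σ' ∧
      t + φ σ' ≤ φ σ₀ + b.cost + 1) σ₀ := by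
  suffices H : ∀ (m : ℕ) (σ : State), φ σ = m → Frame p σ₀ σ → I σ →
      Wp (.while b p) (fun t σ' => Frame p σ₀ σ' ∧ I σ' ∧ ¬ b.holds σ' ∧
        t + φ σ' ≤ φ σ + b.cost + 1) σ from H _ σ₀ rfl (.refl _ _) h₀
  intro m
  induction m using Nat.strong_induction_on with
  | _ m ih =>
    intro σ hm hF hI
    by_cases hb : b.holds σ
    · obtain ⟨t₁, σ₁, hr, hI₁, ht⟩ := hstep σ hF hI hb
      obtain ⟨t₂, σ₂, hr₂, hF₂, hI₂, hb₂, ht₂⟩ :=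
        ih (φ σ₁) (by omega) σ₁ rfl (hF.trans hr.frame) hI₁
      exact ⟨_, _, .whileTrue hb hr hr₂, hF₂, hI₂, hb₂, by omega⟩
    · exact ⟨_, _, .whileFalse hb, hF, hI, hb, by omega⟩

end RealRAM

/-! ### Correctness of the algorithm -/

namespace PSEI

/-- The sum of the first `k` hit values. -/
noncomputable def prefixSum (D : ℕ → ℝ × ℝ) (k : ℕ) : ℝ := ∑ i ∈ Finset.Icc 1 k, (D i).1

theorem prefixSum_zero (D : ℕ → ℝ × ℝ) : prefixSum D 0 = 0 := by simp [prefixSum]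

theorem prefixSum_succ (D : ℕ → ℝ × ℝ) (k : ℕ) :
    prefixSum D (k + 1) = prefixSum D k + (D (k + 1)).1 :=
  Finset.sum_Icc_succ_top (by omega) _

theorem hit_succ (D : ℕ → ℝ × ℝ) {i j : ℕ} (h : i ≤ j) :
    hit D (i + 1, j) = prefixSum D j - prefixSum D i := by
  induction j, h using Nat.le_induction with
  | base => simp [hit]
  | succ j hj ih =>
    rw [prefixSum_succ, hit, Finset.sum_Icc_succ_top (by simpa using hj)]
    simp only [hit] at ih
    rw [ih]
    ring

theorem supp_eq_length {n : ℕ} {D : ℕ → ℝ × ℝ} (hD : Plain n D) {I : ℕ × ℕ}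
    (hI : I ∈ intervals 1 n) : supp D I = length I := by
  have h : ∀ k ∈ Finset.Icc I.1 I.2, (D k).2 = 1 := fun k hk =>
    hD k (hI.1.trans (Finset.mem_Icc.1 hk).1) ((Finset.mem_Icc.1 hk).2.trans hI.2.2)
  rw [supp, Finset.sum_congr rfl h]
  simp [length]

theorem ecc_eq {n : ℕ} {D : ℕ → ℝ × ℝ} (hD : Plain n D) {I : ℕ × ℕ}
    (hI : I ∈ intervals 1 n) : ecc D I = hit D I / Real.sqrt (length I) := by
  rw [ecc, supp_eq_length hD hI]

theorem isSolution_iff {n L : ℕ} {D : ℕ → ℝ × ℝ} (hD : Plain n D) {I : ℕ × ℕ} :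
    IsSolution n L D I ↔ IsArgmax (ecc D) (longIntervals n L) I := by
  have h : ∀ J, J ∈ longIntervals n L ↔ J ∈ intervals 1 n ∧ (L : ℝ) ≤ supp D J := by
    intro J
    refine and_congr_right fun hJ => ?_
    rw [supp_eq_length hD hJ, Nat.cast_le]
  simp only [IsSolution, IsArgmax, h, and_imp]

/-- If all long intervals have negative hit-support, an interval of length at least `2L` can be
shortened without decreasing its eccentricity: cut it into two intervals of length at least `L`;
since `√a + √b ≥ √(a + b)`, the two cannot both be worse. -/
theorem exists_short {n L : ℕ} {D : ℕ → ℝ × ℝ} (hL : 1 ≤ L)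
    (hneg : ∀ J ∈ longIntervals n L, hit D J < 0) {J : ℕ × ℕ} (hJ : J ∈ longIntervals n L) :
    ∃ J' ∈ longIntervals n L, length J' < 2 * L ∧
      hit D J / Real.sqrt (length J) ≤ hit D J' / Real.sqrt (length J') := by
  induction hm : length J using Nat.strong_induction_on generalizing J with
  | _ m ih =>
    rcases lt_or_ge m (2 * L) with h2 | h2
    · exact ⟨J, hJ, hm ▸ h2, by rw [hm]⟩
    obtain ⟨p, q⟩ := J
    obtain ⟨⟨h1, hpq, hqn⟩, hlen⟩ := hJ
    simp only [length] at h1 hpq hqn hlen hm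
    obtain ⟨i, rfl⟩ : ∃ i, p = i + 1 := ⟨p - 1, by omega⟩
    have hA : (i + 1, i + L) ∈ longIntervals n L :=
      ⟨⟨by simp, by simp only; omega, by simp only; omega⟩, by simp only [length]; omega⟩
    have hB : (i + L + 1, q) ∈ longIntervals n L :=
      ⟨⟨by simp, by simp only; omega, by simp only; omega⟩, by simp only [length]; omega⟩
    have hAl : length (i + 1, i + L) = L := by simp [length]
    have hBl : length (i + L + 1, q) = m - L := by simp [length]; omega
    have hJl : length (i + 1, q) = m := by simp [length]; omega
    have hsum : hit D (i + 1, q) = hit D (i + 1, i + L) + hit D (i + L + 1, q) := by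
      rw [hit_succ D (by omega), hit_succ D (by omega), hit_succ D (by omega)]
      ring
    have hAn := hneg _ hA
    have hBn := hneg _ hB
    have hsL : 0 < Real.sqrt L := Real.sqrt_pos.2 (by exact_mod_cast hL)
    have hsM : 0 < Real.sqrt ((m - L : ℕ) : ℝ) := Real.sqrt_pos.2 (by
      exact_mod_cast (by omega : 0 < m - L))
    have hsm : 0 < Real.sqrt m := Real.sqrt_pos.2 (by exact_mod_cast (by omega : 0 < m))
    have hs : Real.sqrt m ≤ Real.sqrt L + Real.sqrt ((m - L : ℕ) : ℝ) := by
      have : (m : ℝ) = L + ((m - L : ℕ) : ℝ) := by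
        rw [← Nat.cast_add]; congr 1; omega
      rw [this]
      refine Real.sqrt_le_iff.2 ⟨by positivity, ?_⟩
      nlinarith [Real.sq_sqrt (Nat.cast_nonneg (α := ℝ) L),
        Real.sq_sqrt (Nat.cast_nonneg (α := ℝ) (m - L)), mul_pos hsL hsM]
    set c := hit D (i + 1, q) / Real.sqrt m with hc
    have hcneg : c < 0 := div_neg_of_neg_of_pos (by rw [hsum]; linarith) hsm
    have hcm : c * Real.sqrt m = hit D (i + 1, q) := by rw [hc]; field_simp
    have key : c ≤ hit D (i + 1, i + L) / Real.sqrt L ∨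
        c ≤ hit D (i + L + 1, q) / Real.sqrt ((m - L : ℕ) : ℝ) := by
      by_contra! hcon
      rw [div_lt_iff₀ hsL, div_lt_iff₀ hsM] at hcon
      nlinarith [hcon.1, hcon.2]
    rcases key with h | h
    · obtain ⟨J', hJ', hl, hle⟩ := ih L (by omega) hA hAl
      exact ⟨J', hJ', hl, h.trans hle⟩
    · obtain ⟨J', hJ', hl, hle⟩ := ih (m - L) (by omega) hB hBl
      exact ⟨J', hJ', hl, h.trans hle⟩

theorem lt_of_lt_numWindows {n L k : ℕ} (hL : 1 ≤ L) (hk : k < numWindows n L) (hk0 : k ≠ 0) :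
    2 * k * L + 2 * L < n := by
  have h : k + 2 ≤ (n + 2 * L - 1) / (2 * L) := by
    rw [numWindows, lt_max_iff] at hk
    omega
  rw [Nat.le_div_iff_mul_le (by omega)] at h
  have : (k + 2) * (2 * L) = 2 * k * L + 4 * L := by ring
  omega

/-- Consecutive windows overlap in `2L` indices, so that every interval of length less than `2L`
lies in one of them. -/
theorem exists_window {n L : ℕ} (hL : 1 ≤ L) {J : ℕ × ℕ} (hJ : J ∈ longIntervals n L)
    (hlen : length J < 2 * L) :
    ∃ k < numWindows n L, J ∈ windowIntervals n L k (length J) := by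
  obtain ⟨p, q⟩ := J
  obtain ⟨⟨h1, hpq, hqn⟩, hl⟩ := hJ
  simp only [length] at h1 hpq hqn hlen hl
  set k := min ((p - 1) / (2 * L)) (numWindows n L - 1) with hk
  have hN : 1 ≤ numWindows n L := le_max_left _ _
  refine ⟨k, by omega, ⟨?_, ?_, ?_⟩, rfl⟩
  · have : k * (2 * L) ≤ p - 1 :=
      (Nat.mul_le_mul_right _ (min_le_left _ _)).trans (Nat.div_mul_le_self _ _)
    have e : 2 * k * L = k * (2 * L) := by ring
    simp only
    omega
  · exact hpq
  · simp only [windowEnd, le_min_iff]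
    refine ⟨hqn, ?_⟩
    have e : 2 * k * L = k * (2 * L) := by ring
    rcases min_choice ((p - 1) / (2 * L)) (numWindows n L - 1) with h | h
    · have := Nat.lt_div_mul_add (a := p - 1) (b := 2 * L) (by omega)
      rw [← h, ← hk] at this
      omega
    · have h' : (n + 2 * L - 1) / (2 * L) ≤ k + 2 := by
        have : (n + 2 * L - 1) / (2 * L) - 1 ≤ numWindows n L := le_max_right _ _
        omega
      have h3 := Nat.lt_div_mul_add (a := n + 2 * L - 1) (b := 2 * L) (by omega)
      have h4 := Nat.mul_le_mul_right (2 * L) h'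
      have : (k + 2) * (2 * L) = k * (2 * L) + 4 * L := by ring
      omega

theorem windowIntervals_subset {n L k j : ℕ} (hj : L ≤ j) :
    windowIntervals n L k j ⊆ longIntervals n L := by
  rintro ⟨p, q⟩ ⟨⟨h1, h2, h3⟩, h4⟩
  exact ⟨⟨by omega, h2, h3.trans (min_le_left _ _)⟩, by omega⟩

theorem windowIntervals_finite (n L k j : ℕ) : (windowIntervals n L k j).Finite := by
  refine ((Set.finite_Iic (windowEnd n L k)).prod (Set.finite_Iic (windowEnd n L k))).subset ?_
  rintro ⟨p, q⟩ ⟨⟨h1, h2, h3⟩, h4⟩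
  exact ⟨h2.trans h3, h3⟩

theorem le_maxHit {n L k j : ℕ} (D : ℕ → ℝ × ℝ) {J : ℕ × ℕ} (hJ : J ∈ windowIntervals n L k j) :
    hit D J ≤ maxHit n L D k j :=
  le_csSup ((windowIntervals_finite n L k j).image _).bddAbove ⟨J, hJ, rfl⟩

theorem length_mem_windowLengths {n L k : ℕ} {J : ℕ × ℕ} (hL : L ≤ length J)
    (hlen : length J < 2 * L) (hJ : J ∈ windowIntervals n L k (length J)) :
    length J ∈ windowLengths n L k := by
  obtain ⟨⟨h1, h2, h3⟩, -⟩ := hJ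
  refine ⟨hL, hlen, ?_⟩
  simp only [length] at *
  omega

/-- A start of an interval of length `j` in the window with maximal eccentricity attains `w_j`. -/
theorem maxHit_div_sqrt {n L k j i : ℕ} {D : ℕ → ℝ × ℝ} (hD : Plain n D) (hL : 1 ≤ L)
    (hj : L ≤ j)
    (hi : IsArgmax (fun i => ecc D (i, i + j - 1))
      {i | (i, i + j - 1) ∈ windowIntervals n L k j} i) :
    ecc D (i, i + j - 1) = maxHit n L D k j / Real.sqrt j := by
  have hs : 0 < Real.sqrt j := Real.sqrt_pos.2 (by exact_mod_cast hL.trans hj)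
  have he : ∀ J ∈ windowIntervals n L k j, ecc D J = hit D J / Real.sqrt j := fun J hJ => by
    rw [ecc_eq hD (windowIntervals_subset hj hJ).1, hJ.2]
  have hmem : (i, i + j - 1) ∈ windowIntervals n L k j := hi.1
  rw [he _ hmem]
  congr 1
  refine le_antisymm (le_maxHit D hmem) (csSup_le ⟨_, _, hmem, rfl⟩ ?_)
  rintro _ ⟨⟨p, q⟩, hJ, rfl⟩
  have hq : q = p + j - 1 := by
    obtain ⟨⟨h1, h2, h3⟩, h4⟩ := hJ
    simp only [length] at *
    omega
  have := hi.2 p (by rw [hq] at hJ; exact hJ)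
  simp only at this
  rw [he _ hmem, ← hq, he _ hJ, div_le_div_iff_of_pos_right hs] at this
  exact this

/-- Every interval that the algorithm may return is a solution. -/
theorem ComputePSEI.isSolution {n L : ℕ} {D : ℕ → ℝ × ℝ} (hD : Plain n D) (hL : 1 ≤ L)
    {I : ℕ × ℕ} (h : ComputePSEI n L D I) : IsSolution n L D I := by
  rw [isSolution_iff hD]
  cases h with
  | zero I hI h0 =>
    refine ⟨hI.1, fun J hJ => ?_⟩
    rw [ecc, ecc, h0, zero_div]
    exact div_nonpos_of_nonpos_of_nonneg (h0 ▸ hI.2 J hJ) (Real.sqrt_nonneg _)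
  | pos I₀ _ hI h0 hJ =>
    have hlen : ∀ X ∈ longIntervals n L, 0 < Real.sqrt (length X) := fun X hX =>
      Real.sqrt_pos.2 (by exact_mod_cast hL.trans hX.2)
    have hpos : 0 < score (length I) (hit D I) := by
      refine lt_of_lt_of_le ?_ (hJ.2 I₀ hI.1)
      simp only [score, if_pos h0.le]
      exact div_pos h0 (hlen I₀ hI.1)
    have hJ0 : 0 ≤ hit D I := by
      by_contra hn
      simp [score, hn] at hpos
    refine ⟨hJ.1, fun X hX => ?_⟩
    have hX' := hJ.2 X hX
    simp only [score] at hX'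
    rw [if_pos hJ0] at hX'
    rw [ecc_eq hD hX.1, ecc_eq hD hJ.1.1]
    refine le_trans ?_ hX'
    split_ifs with hx
    · exact le_rfl
    · exact div_nonpos_of_nonpos_of_nonneg (not_le.1 hx).le (Real.sqrt_nonneg _)
  | neg I₀ hI h0 len start hlen hstart k hk =>
    have hmem : (start k, start k + len k - 1) ∈ windowIntervals n L k (len k) := (hstart k hk.1).1
    refine ⟨windowIntervals_subset (hlen k hk.1).1.1 hmem, fun X hX => ?_⟩
    obtain ⟨Y, hY, hYl, hXY⟩ := exists_short hL (fun J hJ => (hI.2 J hJ).trans_lt h0) hX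
    obtain ⟨k', hk', hYk⟩ := exists_window hL hY hYl
    calc ecc D X ≤ hit D Y / Real.sqrt (length Y) := by rwa [ecc_eq hD hX.1]
      _ ≤ maxHit n L D k' (length Y) / Real.sqrt (length Y) := by
          gcongr
          exact le_maxHit D hYk
      _ ≤ maxHit n L D k' (len k') / Real.sqrt (len k') :=
          (hlen k' hk').2 _ (length_mem_windowLengths hY.2 hYl hYk)
      _ = ecc D (start k', start k' + len k' - 1) :=
          (maxHit_div_sqrt hD hL (hlen k' hk').1.1 (hstart k' hk')).symm
      _ ≤ _ := hk.2 k' hk'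

/-- In the case of negative hit-supports, the algorithm may return any solution of length less than
`2L`. -/
theorem ComputePSEI.of_isArgmax_ecc {n L : ℕ} {D : ℕ → ℝ × ℝ} (hD : Plain n D) (hL : 1 ≤ L)
    (hLn : L ≤ n) {I₀ I : ℕ × ℕ} (hI₀ : IsArgmax (hit D) (longIntervals n L) I₀)
    (h0 : hit D I₀ < 0) (hI : IsArgmax (ecc D) (longIntervals n L) I)
    (hlen : length I < 2 * L) : ComputePSEI n L D I := by
  have h₁ : ∀ k, ∃ j, k < numWindows n L →
      IsArgmax (fun j => maxHit n L D k j / Real.sqrt j) (windowLengths n L k) j := by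
    intro k
    by_cases hk : k < numWindows n L
    · have hfin : (windowLengths n L k).Finite :=
        (Set.finite_Iio (2 * L)).subset fun j hj => hj.2.1
      have hne : (windowLengths n L k).Nonempty := by
        refine ⟨L, le_rfl, by omega, le_min ?_ (by omega)⟩
        by_cases h : k = 0
        · simpa [h] using hLn
        · have := lt_of_lt_numWindows hL hk h
          omega
      obtain ⟨j, hj, hmax⟩ := Set.exists_max_image _
        (fun j : ℕ => maxHit n L D k j / Real.sqrt j) hfin hne
      exact ⟨j, fun _ => ⟨hj, hmax⟩⟩
    · exact ⟨0, fun h => absurd h hk⟩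
  choose len hlen' using h₁
  have h₂ : ∀ k, ∃ i, k < numWindows n L → IsArgmax (fun i => ecc D (i, i + len k - 1))
      {i | (i, i + len k - 1) ∈ windowIntervals n L k (len k)} i := by
    intro k
    by_cases hk : k < numWindows n L
    · have hfin : {i | (i, i + len k - 1) ∈ windowIntervals n L k (len k)}.Finite := by
        refine (Set.finite_Iic n).subset fun i hi => ?_
        have := windowIntervals_subset (hlen' k hk).1.1 hi
        exact this.1.2.1.trans this.1.2.2
      have hne : {i | (i, i + len k - 1) ∈ windowIntervals n L k (len k)}.Nonempty := by
        obtain ⟨a, b, c⟩ := (hlen' k hk).1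
        exact ⟨2 * k * L + 1, ⟨⟨by simp, by simp only; omega, by simp only; omega⟩,
          by simp only [length]; omega⟩⟩
      obtain ⟨i, hi, hmax⟩ := Set.exists_max_image _
        (fun i : ℕ => ecc D (i, i + len k - 1)) hfin hne
      exact ⟨i, fun _ => ⟨hi, hmax⟩⟩
    · exact ⟨0, fun h => absurd h hk⟩
  choose start hstart using h₂
  obtain ⟨k, hk, hIk⟩ := exists_window hL hI.1 hlen
  obtain ⟨p, q⟩ := I
  have hpq : q = p + length (p, q) - 1 := by
    have := hI.1.1.2.1
    simp only [length] at *
    omega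
  set l := length (p, q) with hl
  have hsl : 0 < Real.sqrt l := Real.sqrt_pos.2 (by exact_mod_cast hL.trans hI.1.2)
  have hpl : l ∈ windowLengths n L k := length_mem_windowLengths hI.1.2 hlen hIk
  -- In the window `k` the given solution is chosen, in the others the choices are arbitrary.
  have hlen₂ : ∀ m < numWindows n L,
      IsArgmax (fun j => maxHit n L D m j / Real.sqrt j) (windowLengths n L m)
        (Function.update len k l m) := by
    intro m hm
    by_cases hmk : m = k
    · subst hmk
      rw [Function.update_self]
      refine ⟨hpl, fun j hj => ?_⟩
      refine ((hlen' m hm).2 j hj).trans ?_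
      simp only
      rw [← maxHit_div_sqrt hD hL (hlen' m hm).1.1 (hstart m hm)]
      refine (hI.2 _ (windowIntervals_subset (hlen' m hm).1.1 (hstart m hm).1)).trans ?_
      rw [ecc_eq hD hI.1.1]
      exact div_le_div_of_nonneg_right (le_maxHit D hIk) hsl.le
    · rw [Function.update_of_ne hmk]
      exact hlen' m hm
  have hstart₂ : ∀ m < numWindows n L,
      IsArgmax (fun i => ecc D (i, i + Function.update len k l m - 1))
        {i | (i, i + Function.update len k l m - 1) ∈
          windowIntervals n L m (Function.update len k l m)} (Function.update start k p m) := by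
    intro m hm
    by_cases hmk : m = k
    · subst hmk
      simp only [Function.update_self]
      refine ⟨by rw [Set.mem_ofPred_eq, ← hpq]; exact hIk, fun i hi => ?_⟩
      simp only
      rw [← hpq]
      exact hI.2 _ (windowIntervals_subset hI.1.2 hi)
    · simp only [Function.update_of_ne hmk]
      exact hstart m hm
  have := ComputePSEI.neg I₀ hI₀ h0 _ _ hlen₂ hstart₂ k ⟨hk, fun m hm => by
    simp only
    rw [Function.update_self, Function.update_self, ← hpq]
    exact hI.2 _ (windowIntervals_subset (hlen₂ m hm).1.1 (hstart₂ m hm).1)⟩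
  rwa [Function.update_self, Function.update_self, ← hpq] at this

end PSEI

/-! ### Running a program on disjoint memory -/

namespace RealRAM

/-- All registers and arrays moved up by `100`. -/
def NExpr.shift : NExpr → NExpr
  | const c => const c
  | reg x => reg (x + 100)
  | get a e => get (a + 100) e.shift
  | add e₁ e₂ => add e₁.shift e₂.shift
  | sub e₁ e₂ => sub e₁.shift e₂.shift

/-- All registers and arrays moved up by `100`. -/
def RExpr.shift : RExpr → RExpr
  | ofNat e => ofNat e.shift
  | reg x => reg (x + 100)
  | get a e => get (a + 100) e.shift
  | add e₁ e₂ => add e₁.shift e₂.shift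
  | sub e₁ e₂ => sub e₁.shift e₂.shift
  | mul e₁ e₂ => mul e₁.shift e₂.shift
  | div e₁ e₂ => div e₁.shift e₂.shift
  | sqrt e => sqrt e.shift

/-- All registers and arrays moved up by `100`. -/
def BExpr.shift : BExpr → BExpr
  | natLe e₁ e₂ => natLe e₁.shift e₂.shift
  | realLe e₁ e₂ => realLe e₁.shift e₂.shift
  | not b => not b.shift
  | and b₁ b₂ => and b₁.shift b₂.shift

/-- The same program, working on registers and arrays whose names are moved up by `100`. -/
def Prog.shift : Prog → Prog
  | skip => skip
  | setNat x e => setNat (x + 100) e.shift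
  | setReal x e => setReal (x + 100) e.shift
  | storeNat a i e => storeNat (a + 100) i.shift e.shift
  | storeReal a i e => storeReal (a + 100) i.shift e.shift
  | seq p q => seq p.shift q.shift
  | ite b p q => ite b.shift p.shift q.shift
  | .while b p => .while b.shift p.shift

/-- The part of the memory that shifted programs work on. -/
def State.upper (σ : State) : State where
  nat x := σ.nat (x + 100)
  real x := σ.real (x + 100)
  natArr a := σ.natArr (a + 100)
  realArr a := σ.realArr (a + 100)

theorem NExpr.eval_shift (σ : State) (e : NExpr) : e.shift.eval σ = e.eval σ.upper := by
  induction e <;> simp_all [shift, eval, State.upper]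

theorem NExpr.cost_shift (e : NExpr) : e.shift.cost = e.cost := by
  induction e <;> simp_all [shift, cost]

theorem RExpr.eval_shift (σ : State) (e : RExpr) : e.shift.eval σ = e.eval σ.upper := by
  induction e <;> simp_all [shift, eval, State.upper, NExpr.eval_shift]

theorem RExpr.cost_shift (e : RExpr) : e.shift.cost = e.cost := by
  induction e <;> simp_all [shift, cost, NExpr.cost_shift]

theorem BExpr.holds_shift (σ : State) (b : BExpr) : b.shift.holds σ ↔ b.holds σ.upper := by
  induction b <;> simp_all [shift, holds, NExpr.eval_shift, RExpr.eval_shift]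

theorem BExpr.cost_shift (b : BExpr) : b.shift.cost = b.cost := by
  induction b <;> simp_all [shift, cost, NExpr.cost_shift, RExpr.cost_shift]

theorem State.upper_setNat (σ : State) (x v : ℕ) :
    (σ.setNat (x + 100) v).upper = σ.upper.setNat x v := by
  simp only [upper, setNat, Function.update_apply, State.mk.injEq, and_true]
  ext y
  simp [Function.update_apply]

theorem State.upper_setReal (σ : State) (x : ℕ) (v : ℝ) :
    (σ.setReal (x + 100) v).upper = σ.upper.setReal x v := by
  simp only [upper, setReal, Function.update_apply, State.mk.injEq, and_true, true_and]
  ext y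
  simp [Function.update_apply]

theorem State.upper_storeNat (σ : State) (a i v : ℕ) :
    (σ.storeNat (a + 100) i v).upper = σ.upper.storeNat a i v := by
  simp only [upper, storeNat, State.mk.injEq, and_true, true_and]
  ext b j
  by_cases h : b = a <;> simp [Function.update_apply, h]

theorem State.upper_storeReal (σ : State) (a i : ℕ) (v : ℝ) :
    (σ.storeReal (a + 100) i v).upper = σ.upper.storeReal a i v := by
  simp only [upper, storeReal, State.mk.injEq, true_and]
  ext b j
  by_cases h : b = a <;> simp [Function.update_apply, h]

/-- A shifted program acts on the upper part of the memory as the program itself. -/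
theorem Run.shift {p : Prog} {τ τ' : State} {t : ℕ} (h : Run p τ t τ') :
    ∀ σ : State, σ.upper = τ → ∃ σ' : State, Run p.shift σ t σ' ∧ σ'.upper = τ' := by
  induction h with
  | skip => intro σ hσ; exact ⟨σ, .skip σ, hσ⟩
  | setNat _ x e =>
    rintro σ rfl
    refine ⟨_, ?_, State.upper_setNat σ x _⟩
    rw [← NExpr.eval_shift, ← NExpr.cost_shift]
    exact .setNat ..
  | setReal _ x e =>
    rintro σ rfl
    refine ⟨_, ?_, State.upper_setReal σ x _⟩
    rw [← RExpr.eval_shift, ← RExpr.cost_shift]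
    exact .setReal ..
  | storeNat _ a i e =>
    rintro σ rfl
    refine ⟨_, ?_, State.upper_storeNat σ a _ _⟩
    rw [← NExpr.eval_shift, ← NExpr.eval_shift, ← NExpr.cost_shift, ← NExpr.cost_shift e]
    exact .storeNat ..
  | storeReal _ a i e =>
    rintro σ rfl
    refine ⟨_, ?_, State.upper_storeReal σ a _ _⟩
    rw [← NExpr.eval_shift, ← RExpr.eval_shift, ← NExpr.cost_shift, ← RExpr.cost_shift]
    exact .storeReal ..
  | seq _ _ ih₁ ih₂ =>
    intro σ hσ
    obtain ⟨σ₁, h₁, e₁⟩ := ih₁ σ hσ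
    obtain ⟨σ₂, h₂, e₂⟩ := ih₂ σ₁ e₁
    exact ⟨σ₂, .seq h₁ h₂, e₂⟩
  | iteTrue hb _ ih =>
    rintro σ rfl
    obtain ⟨σ₁, h₁, e₁⟩ := ih σ rfl
    refine ⟨σ₁, ?_, e₁⟩
    rw [← BExpr.cost_shift]
    exact .iteTrue ((BExpr.holds_shift ..).2 hb) h₁
  | iteFalse hb _ ih =>
    rintro σ rfl
    obtain ⟨σ₁, h₁, e₁⟩ := ih σ rfl
    refine ⟨σ₁, ?_, e₁⟩
    rw [← BExpr.cost_shift]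
    exact .iteFalse (mt (BExpr.holds_shift ..).1 hb) h₁
  | whileFalse hb =>
    rintro σ rfl
    refine ⟨σ, ?_, rfl⟩
    rw [← BExpr.cost_shift]
    exact .whileFalse (mt (BExpr.holds_shift ..).1 hb)
  | whileTrue hb _ _ ih₁ ih₂ =>
    rintro σ rfl
    obtain ⟨σ₁, h₁, e₁⟩ := ih₁ σ rfl
    obtain ⟨σ₂, h₂, e₂⟩ := ih₂ σ₁ e₁
    refine ⟨σ₂, ?_, e₂⟩
    rw [← BExpr.cost_shift]
    exact .whileTrue ((BExpr.holds_shift ..).2 hb) h₁ h₂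

namespace Prog

variable (p : Prog) {x : ℕ}

theorem writesNat_shift (hx : x < 100) : p.shift.writesNat x = false := by
  induction p <;> simp_all [shift, writesNat]
  omega

theorem writesReal_shift (hx : x < 100) : p.shift.writesReal x = false := by
  induction p <;> simp_all [shift, writesReal]
  omega

theorem writesRealArr_shift (hx : x < 100) : p.shift.writesRealArr x = false := by
  induction p <;> simp_all [shift, writesRealArr]
  omega

end Prog

/-! ### Min-plus products on the real RAM -/

/-- A program running for `t` time units changes at most `t` entries of an array. -/
theorem Run.exists_changes {p : Prog} {σ σ' : State} {t : ℕ} (h : Run p σ t σ') (a : ℕ) :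
    ∃ S : Finset ℕ, S.card ≤ t ∧ ∀ i ∉ S, σ'.realArr a i = σ.realArr a i := by
  induction h with
  | skip | setNat | setReal | storeNat => exact ⟨∅, by simp, by simp⟩
  | storeReal σ b i e =>
    refine ⟨{i.eval σ}, by simp, fun j hj => ?_⟩
    simp only [Finset.mem_singleton] at hj
    simp [hj]
  | seq _ _ ih₁ ih₂ =>
    obtain ⟨S₁, c₁, h₁⟩ := ih₁
    obtain ⟨S₂, c₂, h₂⟩ := ih₂
    refine ⟨S₁ ∪ S₂, (Finset.card_union_le _ _).trans (by omega), fun i hi => ?_⟩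
    simp only [Finset.mem_union, not_or] at hi
    rw [h₂ i hi.2, h₁ i hi.1]
  | iteTrue _ _ ih | iteFalse _ _ ih =>
    obtain ⟨S, c, h⟩ := ih
    exact ⟨S, by omega, h⟩
  | whileFalse => exact ⟨∅, by simp, by simp⟩
  | whileTrue _ _ _ ih₁ ih₂ =>
    obtain ⟨S₁, c₁, h₁⟩ := ih₁
    obtain ⟨S₂, c₂, h₂⟩ := ih₂
    refine ⟨S₁ ∪ S₂, (Finset.card_union_le _ _).trans (by omega), fun i hi => ?_⟩
    simp only [Finset.mem_union, not_or] at hi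
    rw [h₂ i hi.2, h₁ i hi.1]

/-- Every entry of the product has to be written, as the memory for the output may initially hold
different values. -/
theorem _root_.ComputesMinPlusProduct.sq_le {M : Prog} {T : ℕ → ℝ}
    (hM : ComputesMinPlusProduct M T) {d : ℕ} (hd : 1 ≤ d) : (d : ℝ) ^ 2 ≤ T d := by
  have : Nonempty (Fin d) := ⟨⟨0, hd⟩⟩
  obtain ⟨t, σ', hr, ht, hC⟩ := hM d hd 0 0
    ⟨fun _ => d, fun _ => 0, fun _ _ => 0, fun a _ => if a = 2 then 1 else 0⟩
    rfl (fun _ _ => rfl) (fun _ _ => rfl)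
  obtain ⟨S, hS, hch⟩ := hr.exists_changes 2
  have hinj : Function.Injective fun p : Fin d × Fin d => (finProdFinEquiv p : ℕ) :=
    Fin.val_injective.comp finProdFinEquiv.injective
  have hcard : (Finset.univ.image fun p : Fin d × Fin d => (finProdFinEquiv p : ℕ)).card ≤
      S.card := by
    refine Finset.card_le_card fun i hi => ?_
    obtain ⟨⟨x, y⟩, -, rfl⟩ := Finset.mem_image.1 hi
    by_contra hn
    have h₁ := hC x y
    have h₂ := hch _ hn
    have e : (finProdFinEquiv (x, y) : ℕ) = x.val * d + y.val := by
      simp [finProdFinEquiv, add_comm, mul_comm]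
    simp only [e, if_true] at h₂
    simp [minPlusProduct, h₂] at h₁
  rw [Finset.card_image_of_injective _ hinj] at hcard
  simp only [Finset.card_univ, Fintype.card_prod, Fintype.card_fin] at hcard
  refine le_trans ?_ ht
  rw [sq]
  exact_mod_cast hcard.trans hS

/-- Calling a program for min-plus products from a program that uses names below `100` only. -/
theorem _root_.ComputesMinPlusProduct.wp_shift {M : Prog} {T : ℕ → ℝ}
    (hM : ComputesMinPlusProduct M T) {d : ℕ} (hd : 1 ≤ d) {σ : State} (hσ : σ.nat 100 = d) :
    Wp M.shift (fun t σ' => t ≤ ⌊T d⌋₊ ∧ ∀ x < d, ∀ r < d,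
      (∀ y < d, σ'.realArr 102 (x * d + r) ≤
        σ.realArr 100 (x * d + y) + σ.realArr 101 (y * d + r)) ∧
      ∃ y < d, σ'.realArr 102 (x * d + r) =
        σ.realArr 100 (x * d + y) + σ.realArr 101 (y * d + r)) σ := by
  have : Nonempty (Fin d) := ⟨⟨0, hd⟩⟩
  obtain ⟨t, τ', hr, ht, hC⟩ := hM d hd (fun i j => σ.realArr 100 (i.val * d + j.val))
    (fun i j => σ.realArr 101 (i.val * d + j.val)) σ.upper hσ (fun _ _ => rfl) (fun _ _ => rfl)
  obtain ⟨σ', hr', rfl⟩ := hr.shift σ rfl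
  refine ⟨t, σ', hr', Nat.le_floor ht, fun x hx r hr => ?_⟩
  have h := hC ⟨x, hx⟩ ⟨r, hr⟩
  change σ'.realArr 102 (x * d + r) = ⨅ y : Fin d, _ at h
  rw [h]
  refine ⟨fun y hy => ciInf_le (Set.finite_range _).bddBelow (⟨y, hy⟩ : Fin d), ?_⟩
  obtain ⟨y, hy⟩ := exists_eq_ciInf_of_finite (f := fun y : Fin d =>
    σ.realArr 100 (x * d + y.val) + σ.realArr 101 (y.val * d + r))
  exact ⟨y, y.2, hy.symm⟩

end RealRAM

/-! ### Prefix sums and the interval of largest hit-support -/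

namespace RealRAM

attribute [simp] NExpr.eval NExpr.cost RExpr.eval RExpr.cost BExpr.holds BExpr.cost
  wp_skip wp_setNat wp_setReal wp_storeNat wp_storeReal wp_seq wp_ite

end RealRAM

namespace PSEI

open RealRAM

/-- The memory `σ` holds `n` and `L` in the integer registers `0` and `1`, and the numbers
`P 0, …, P n` in the real array `2`. -/
structure HoldsSums (n L : ℕ) (P : ℕ → ℝ) (σ : State) : Prop where
  size : σ.nat 0 = n
  bound : σ.nat 1 = L
  sums : ∀ k ≤ n, σ.realArr 2 k = P k

theorem HoldsSums.frame {n L : ℕ} {P : ℕ → ℝ} {p : Prog} {σ σ' : State} (h : HoldsSums n L P σ)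
    (hF : Frame p σ σ') (h₀ : p.writesNat 0 = false) (h₁ : p.writesNat 1 = false)
    (h₂ : p.writesRealArr 2 = false) : HoldsSums n L P σ' :=
  ⟨(hF.nat 0 h₀).trans h.size, (hF.nat 1 h₁).trans h.bound,
    fun k hk => (congrFun (hF.realArr 2 h₂) k).trans (h.sums k hk)⟩

/-- Computes the prefix sums, and in the real register `0` an upper bound for their absolute
values. -/
def prefixSums : Prog :=
  .seq (.setNat 2 (.const 0)) <|
  .seq (.setReal 0 (.ofNat (.const 0))) <|
  .seq (.storeReal 2 (.const 0) (.ofNat (.const 0))) <|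
  .while (.natLe (.add (.reg 2) (.const 1)) (.reg 0)) <|
    .seq (.setNat 2 (.add (.reg 2) (.const 1))) <|
    .seq (.storeReal 2 (.reg 2) (.add (.get 2 (.sub (.reg 2) (.const 1))) (.get 0 (.reg 2)))) <|
    .setReal 0 (.add (.reg 0) (.sqrt (.mul (.get 0 (.reg 2)) (.get 0 (.reg 2)))))

theorem prefixSums_spec {n L : ℕ} {D : ℕ → ℝ × ℝ} {σ : State} (h : HoldsInput n L D σ) :
    Wp prefixSums (fun t σ' => t ≤ 100 * (n + 1) ∧ HoldsSums n L (prefixSum D) σ' ∧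
      ∀ k ≤ n, |prefixSum D k| ≤ σ'.real 0) σ := by
  obtain ⟨h0, h1, hD⟩ := h
  simp only [prefixSums, wp_seq, wp_setNat, wp_setReal, wp_storeReal]
  refine (wp_while (fun σ => σ.nat 2 ≤ n ∧ (∀ k ≤ σ.nat 2, σ.realArr 2 k = prefixSum D k) ∧
    ∀ k ≤ σ.nat 2, |prefixSum D k| ≤ σ.real 0) (fun σ => 60 * (n - σ.nat 2)) ?_ ?_).mono ?_
  · simp [prefixSum_zero]
  · intro σ₁ hF ⟨hk, hP, hb⟩ hlt
    have e0 : σ₁.nat 0 = n := (hF.nat 0 rfl).trans (by simpa using h0)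
    have eD : σ₁.realArr 0 (σ₁.nat 2 + 1) = (D (σ₁.nat 2 + 1)).1 := by
      simp only [BExpr.holds, NExpr.eval, e0] at hlt
      rw [hF.realArr 0 rfl]
      simpa using (hD (σ₁.nat 2 + 1) (by omega) hlt).1
    simp [e0, eD, hP _ le_rfl] at hlt ⊢
    refine ⟨⟨hlt, fun k hk => ?_, fun k hk => ?_⟩, by omega⟩
    · split_ifs with h
      · rw [h, prefixSum_succ]
      · exact hP k (by omega)
    · rw [Real.sqrt_mul_self_eq_abs]
      rcases Nat.le_succ_iff.1 hk with h | rfl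
      · exact (hb k h).trans (le_add_of_nonneg_right (abs_nonneg _))
      · rw [prefixSum_succ]
        exact (abs_add_le _ _).trans (by gcongr; exact hb _ le_rfl)
  · rintro t σ₁ ⟨hF, ⟨hk, hP, hb⟩, hlt, ht⟩
    have e0 : σ₁.nat 0 = n := (hF.nat 0 rfl).trans (by simpa using h0)
    have e1 : σ₁.nat 1 = L := (hF.nat 1 rfl).trans (by simpa using h1)
    simp [e0] at hlt ht ⊢
    have e : σ₁.nat 2 = n := le_antisymm hk hlt
    rw [e] at hP hb
    exact ⟨by omega, ⟨e0, e1, hP⟩, hb⟩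

/-- Computes `i` and `j`, in the integer registers `4` and `5`, such that `P j - P i` is maximal
subject to `i + L ≤ j`. The register `6` runs through the values of `j`, and the register `3` holds
the position of the smallest of the numbers `P 0, …, P (j - L)`. -/
def maxDiff : Prog :=
  .seq (.setNat 3 (.const 0)) <|
  .seq (.setNat 4 (.const 0)) <|
  .seq (.setNat 5 (.reg 1)) <|
  .seq (.setNat 6 (.reg 1)) <|
  .while (.natLe (.add (.reg 6) (.const 1)) (.reg 0)) <|
    .seq (.setNat 6 (.add (.reg 6) (.const 1))) <|
    .seq (.ite (.realLe (.get 2 (.sub (.reg 6) (.reg 1))) (.get 2 (.reg 3)))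
      (.setNat 3 (.sub (.reg 6) (.reg 1))) .skip) <|
    .ite (.realLe (.sub (.get 2 (.reg 5)) (.get 2 (.reg 4)))
        (.sub (.get 2 (.reg 6)) (.get 2 (.reg 3))))
      (.seq (.setNat 4 (.reg 3)) (.setNat 5 (.reg 6))) .skip

theorem maxDiff_spec {n L : ℕ} {P : ℕ → ℝ} {σ : State} (h : HoldsSums n L P σ) (hL : L ≤ n) :
    Wp maxDiff (fun t σ' => t ≤ 100 * (n + 1) ∧
      σ'.nat 4 + L ≤ σ'.nat 5 ∧ σ'.nat 5 ≤ n ∧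
      ∀ i j, i + L ≤ j → j ≤ n → P j - P i ≤ P (σ'.nat 5) - P (σ'.nat 4)) σ := by
  obtain ⟨h0, h1, hP⟩ := h
  simp only [maxDiff, wp_seq, wp_setNat]
  refine (wp_while (fun σ => σ.nat 6 ≤ n ∧ σ.nat 3 + L ≤ σ.nat 6 ∧
    (∀ i, i + L ≤ σ.nat 6 → P (σ.nat 3) ≤ P i) ∧ σ.nat 4 + L ≤ σ.nat 5 ∧ σ.nat 5 ≤ σ.nat 6 ∧
    ∀ i j, i + L ≤ j → j ≤ σ.nat 6 → P j - P i ≤ P (σ.nat 5) - P (σ.nat 4))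
    (fun σ => 60 * (n - σ.nat 6)) ?_ ?_).mono ?_
  · simp [h1, hL]
    intro i j hij hj
    obtain ⟨rfl, rfl⟩ : i = 0 ∧ j = L := by omega
    simp
  · intro σ₁ hF ⟨hj, hm, hmin, hb, hbj, hmax⟩ hlt
    have e0 : σ₁.nat 0 = n := (hF.nat 0 rfl).trans (by simpa using h0)
    have e1 : σ₁.nat 1 = L := (hF.nat 1 rfl).trans (by simpa using h1)
    have eP : ∀ k ≤ n, σ₁.realArr 2 k = P k := fun k hk =>
      (congrFun (hF.realArr 2 rfl) k).trans (by simpa using hP k hk)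
    simp [e0] at hlt
    have hmin₁ : P (σ₁.nat 6 + 1 - L) ≤ P (σ₁.nat 3) →
        ∀ i, i + L ≤ σ₁.nat 6 + 1 → P (σ₁.nat 6 + 1 - L) ≤ P i := fun h i hi => by
      rcases Nat.le_succ_iff.1 hi with h' | h'
      · exact h.trans (hmin i h')
      · rw [show i = σ₁.nat 6 + 1 - L by omega]
    have hmin₂ : P (σ₁.nat 3) < P (σ₁.nat 6 + 1 - L) →
        ∀ i, i + L ≤ σ₁.nat 6 + 1 → P (σ₁.nat 3) ≤ P i := fun h i hi => by
      rcases Nat.le_succ_iff.1 hi with h' | h'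
      · exact hmin i h'
      · rw [show i = σ₁.nat 6 + 1 - L by omega]
        exact h.le
    have key : ∀ m, (∀ i, i + L ≤ σ₁.nat 6 + 1 → P m ≤ P i) → ∀ i k, i + L ≤ k →
        k ≤ σ₁.nat 6 + 1 → P k - P i ≤ P (σ₁.nat 5) - P (σ₁.nat 4) ∨
          P k - P i ≤ P (σ₁.nat 6 + 1) - P m := by
      intro m hm' i k hik hk
      rcases Nat.le_succ_iff.1 hk with h | rfl
      · exact .inl (hmax i k hik h)
      · exact .inr (by linarith [hm' i hik])
    simp [e1, eP _ (by omega : σ₁.nat 6 + 1 - L ≤ n), eP _ (by omega : σ₁.nat 3 ≤ n),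
      eP _ (by omega : σ₁.nat 4 ≤ n), eP _ (by omega : σ₁.nat 5 ≤ n),
      eP _ (by omega : σ₁.nat 6 + 1 ≤ n), -tsub_le_iff_right]
    refine ⟨fun h => ⟨fun h' => ?_, fun h' => ?_⟩, fun h => ⟨fun h' => ?_, fun h' => ?_⟩⟩
    · refine ⟨⟨hlt, by omega, hmin₁ h, by omega, fun i k hik hk => ?_⟩, by omega⟩
      rcases key _ (hmin₁ h) i k hik hk with h | h <;> linarith
    · refine ⟨⟨hlt, by omega, hmin₁ h, hb, by omega, fun i k hik hk => ?_⟩, by omega⟩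
      rcases key _ (hmin₁ h) i k hik hk with h | h <;> linarith
    · refine ⟨⟨hlt, by omega, hmin₂ h, by omega, fun i k hik hk => ?_⟩, by omega⟩
      rcases key _ (hmin₂ h) i k hik hk with h | h <;> linarith
    · refine ⟨⟨hlt, by omega, hmin₂ h, hb, by omega, fun i k hik hk => ?_⟩, by omega⟩
      rcases key _ (hmin₂ h) i k hik hk with h | h <;> linarith
  · rintro t σ₁ ⟨hF, ⟨hj, hm, hmin, hb, hbj, hmax⟩, hlt, ht⟩
    have e0 : σ₁.nat 0 = n := (hF.nat 0 rfl).trans (by simpa using h0)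
    simp [e0, -tsub_le_iff_right] at hlt ht ⊢
    have e : σ₁.nat 6 = n := le_antisymm hj hlt
    rw [e] at hmax
    exact ⟨by omega, hb, by omega, hmax⟩

end PSEI

/-! ### Chords of the graph of the prefix sums -/

namespace PSEI

open RealRAM

/-- The slope of the chord from `(a, P a)` to `(b, P b)`, for `a < b`. -/
noncomputable def chord (P : ℕ → ℝ) (a b : ℕ) : ℝ := (P b - P a) / ((b - a : ℕ) : ℝ)

/-- The eccentricity of the index interval `[a + 1, b]`, in terms of the prefix sums. -/
noncomputable def diffEcc (P : ℕ → ℝ) (a b : ℕ) : ℝ := (P b - P a) / Real.sqrt ((b - a : ℕ) : ℝ)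

section Chord

variable {P : ℕ → ℝ} {a b : ℕ} {s : ℝ}

theorem chord_le_iff (h : a < b) : chord P a b ≤ s ↔ P b - s * b ≤ P a - s * a := by
  have h' : (0 : ℝ) < b - a := by rw [sub_pos]; exact_mod_cast h
  rw [chord, Nat.cast_sub h.le, div_le_iff₀ h']
  constructor <;> intro <;> linarith

theorem le_chord_iff (h : a < b) : s ≤ chord P a b ↔ P a - s * a ≤ P b - s * b := by
  have h' : (0 : ℝ) < b - a := by rw [sub_pos]; exact_mod_cast h
  rw [chord, Nat.cast_sub h.le, le_div_iff₀ h']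
  constructor <;> intro <;> linarith

/-- If the largest slope from `t` to later points is that of the chord to `u`, and `t` is below the
chord from `j` to `u`, then no point between `j` and `u` is above that chord. -/
theorem chord_le_chord_of_pop {n j t u : ℕ} (hjt : j < t) (htu : t < u) (hun : u ≤ n)
    (h : chord P j t ≤ chord P t u) (h₁ : ∀ k, j < k → k ≤ t → chord P j k ≤ chord P j t)
    (h₂ : ∀ k, t < k → k ≤ n → chord P t k ≤ chord P t u) :
    ∀ k, j < k → k ≤ u → chord P j k ≤ chord P j u := by
  have hju := hjt.trans htu
  have e₁ := (le_chord_iff hjt).1 (le_refl (chord P j t))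
  have e₂ := (chord_le_iff hjt).1 (le_refl (chord P j t))
  have e₃ := (le_chord_iff htu).1 h
  have htj : chord P j t ≤ chord P j u := (le_chord_iff hju).2 (by linarith)
  intro k hjk hku
  rcases le_or_gt k t with hkt | hkt
  · exact (h₁ k hjk hkt).trans htj
  rw [chord_le_iff hjk]
  have f₁ := (chord_le_iff hkt).1 (h₂ k hkt (hku.trans hun))
  have f₂ := (chord_le_iff htu).1 (le_refl (chord P t u))
  have f₃ := (le_chord_iff htu).1 (le_refl (chord P t u))
  have f₄ := (chord_le_iff hju).1 (le_refl (chord P j u))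
  have f₅ := (le_chord_iff hju).1 (le_refl (chord P j u))
  have f₆ := (chord_le_iff hjt).1 htj
  have f₇ : chord P j u ≤ chord P t u := (le_chord_iff htu).2 (by linarith)
  have f₈ : (k : ℝ) ≤ u := by exact_mod_cast hku
  nlinarith [mul_nonneg (sub_nonneg.2 f₇) (sub_nonneg.2 f₈)]

/-- If the largest slope from `t` to later points is less than the slope from `j` to `t`, then these
points are below the line through `j` and `t`. -/
theorem chord_le_chord_of_stop {n j t u : ℕ} (hjt : j < t)
    (h : chord P t u < chord P j t) (h₁ : ∀ k, j < k → k ≤ t → chord P j k ≤ chord P j t)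
    (h₂ : ∀ k, t < k → k ≤ n → chord P t k ≤ chord P t u) :
    ∀ k, j < k → k ≤ n → chord P j k ≤ chord P j t := by
  intro k hjk hkn
  rcases le_or_gt k t with hkt | hkt
  · exact h₁ k hjk hkt
  have f₁ := (chord_le_iff hkt).1 ((h₂ k hkt hkn).trans h.le)
  have f₂ := (chord_le_iff hjt).1 (le_refl (chord P j t))
  rw [chord_le_iff hjk]
  linarith

end Chord

/-- `r` is the largest slope of a chord from `j` to a later point, or `0` if there is no later
point. -/
def IsRightSlope (n : ℕ) (P : ℕ → ℝ) (j : ℕ) (r : ℝ) : Prop :=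
  (∀ k, j < k → k ≤ n → chord P j k ≤ r) ∧ (r = 0 ∨ ∃ k, j < k ∧ k ≤ n ∧ r = chord P j k)

/-- The slope of the chord from `a` to `b`. -/
def chordExpr (a b : NExpr) : RExpr := .div (.sub (.get 2 b) (.get 2 a)) (.ofNat (.sub b a))

/-- Computes the largest slopes of chords from `j` to later points, in the real array `3`, for
`j = n, …, 0`. The integer array `0` is a stack, with its top at the position given by the register
`7`, that holds the vertices of the upper convex hull of the points from `j` on. -/
def rightSlopes : Prog :=
  .seq (.storeNat 0 (.const 0) (.reg 0)) <|
  .seq (.setNat 7 (.const 0)) <|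
  .seq (.storeReal 3 (.reg 0) (.ofNat (.const 0))) <|
  .seq (.setNat 6 (.reg 0)) <|
  .while (.natLe (.const 1) (.reg 6)) <|
    .seq (.setNat 6 (.sub (.reg 6) (.const 1))) <|
    .seq (.while (.and (.natLe (.const 1) (.reg 7))
        (.realLe (chordExpr (.reg 6) (.get 0 (.reg 7)))
          (chordExpr (.get 0 (.reg 7)) (.get 0 (.sub (.reg 7) (.const 1))))))
      (.setNat 7 (.sub (.reg 7) (.const 1)))) <|
    .seq (.storeReal 3 (.reg 6) (chordExpr (.reg 6) (.get 0 (.reg 7)))) <|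
    .seq (.setNat 7 (.add (.reg 7) (.const 1))) <|
    .storeNat 0 (.reg 7) (.reg 6)

theorem chordExpr_eval {n L : ℕ} {P : ℕ → ℝ} {σ : State} (h : HoldsSums n L P σ) {a b : NExpr}
    (ha : a.eval σ ≤ n) (hb : b.eval σ ≤ n) :
    (chordExpr a b).eval σ = chord P (a.eval σ) (b.eval σ) := by
  simp [chordExpr, chord, h.sums _ ha, h.sums _ hb]

theorem rightSlopes_spec {n L : ℕ} {P : ℕ → ℝ} {σ : State} (h : HoldsSums n L P σ) :
    Wp rightSlopes (fun t σ' => t ≤ 400 * (n + 1) ∧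
      ∀ j ≤ n, IsRightSlope n P j (σ'.realArr 3 j)) σ := by
  simp only [rightSlopes, wp_seq, wp_setNat, wp_storeReal, wp_storeNat]
  refine (wp_while (fun σ => σ.nat 6 ≤ n ∧ σ.natArr 0 0 = n ∧ σ.natArr 0 (σ.nat 7) = σ.nat 6 ∧
    (∀ m ≤ σ.nat 7, σ.natArr 0 m ≤ n) ∧
    (∀ m < σ.nat 7, σ.natArr 0 (m + 1) < σ.natArr 0 m ∧ ∀ k, σ.natArr 0 (m + 1) < k → k ≤ n →
      chord P (σ.natArr 0 (m + 1)) k ≤ chord P (σ.natArr 0 (m + 1)) (σ.natArr 0 m)) ∧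
    ∀ i, σ.nat 6 ≤ i → i ≤ n → IsRightSlope n P i (σ.realArr 3 i))
    (fun σ => 200 * σ.nat 6 + 100 * σ.nat 7) ?_ ?_).mono ?_
  · simp [h.size]
    intro i hi hi'
    obtain rfl : i = n := by omega
    exact ⟨fun k hk hk' => absurd hk (by omega), .inl (by simp)⟩
  · intro σ₁ hF ⟨hj, hS0, htop, hSn, hS, hr⟩ hlt
    have hH : HoldsSums n L P σ₁ := by
      refine ⟨(hF.nat 0 rfl).trans (by simpa using h.size),
        (hF.nat 1 rfl).trans (by simpa using h.bound), fun k hk => ?_⟩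
      rw [hF.realArr 2 rfl]
      simpa using h.sums k hk
    obtain ⟨j, hj'⟩ : ∃ j, σ₁.nat 6 = j + 1 := by
      simp at hlt
      exact ⟨σ₁.nat 6 - 1, by omega⟩
    simp only [wp_seq, wp_setNat]
    set σ₂ := σ₁.setNat 6 (NExpr.eval σ₁ (.sub (.reg 6) (.const 1))) with hσ₂
    have e6 : σ₂.nat 6 = j := by simp [hσ₂, hj']
    have e7 : σ₂.nat 7 = σ₁.nat 7 := by simp [hσ₂]
    have eA : σ₂.natArr 0 = σ₁.natArr 0 := by simp [hσ₂]
    have eR : σ₂.realArr 3 = σ₁.realArr 3 := by simp [hσ₂]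
    have hH₂ : HoldsSums n L P σ₂ := ⟨by simp [hσ₂, hH.size], by simp [hσ₂, hH.bound],
      by simpa [hσ₂] using hH.sums⟩
    clear_value σ₂
    refine (wp_while (fun σ => σ.nat 7 ≤ σ₁.nat 7 ∧ j < σ₁.natArr 0 (σ.nat 7) ∧
      ∀ k, j < k → k ≤ σ₁.natArr 0 (σ.nat 7) → chord P j k ≤ chord P j (σ₁.natArr 0 (σ.nat 7)))
      (fun σ => 100 * σ.nat 7) ?_ ?_).mono ?_
    · refine ⟨e7.le, by rw [e7, htop]; omega, fun k hk hk' => ?_⟩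
      rw [e7, htop, hj'] at hk' ⊢
      obtain rfl : k = j + 1 := by omega
      exact le_rfl
    · intro σ₃ hF₃ ⟨h7, hlt₃, hmax⟩ hcond
      have hH₃ := hH₂.frame hF₃ rfl rfl rfl
      have e6₃ : σ₃.nat 6 = j := (hF₃.nat 6 rfl).trans e6
      have eA₃ : σ₃.natArr 0 = σ₁.natArr 0 := (hF₃.natArr 0 rfl).trans eA
      obtain ⟨hsp, hc⟩ := hcond
      obtain ⟨m, hm⟩ : ∃ m, σ₃.nat 7 = m + 1 := by
        simp at hsp
        exact ⟨σ₃.nat 7 - 1, by omega⟩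
      obtain ⟨hdec, hms⟩ := hS m (by omega)
      simp only [BExpr.holds] at hc
      rw [chordExpr_eval hH₃ (by simp [e6₃]; omega) (by simpa [eA₃] using hSn _ h7),
        chordExpr_eval hH₃ (by simpa [eA₃] using hSn _ h7)
          (by simpa [eA₃] using hSn _ (by omega))] at hc
      simp [e6₃, eA₃, hm] at hc
      simp [hm, chordExpr]
      rw [hm] at hmax hlt₃ h7
      exact ⟨⟨by omega, hlt₃.trans hdec,
        chord_le_chord_of_pop hlt₃ hdec (hSn _ (by omega)) hc hmax hms⟩, by omega⟩
    · rintro t₁ σ₃ ⟨hF₃, ⟨h7, hlt₃, hmax⟩, hcond, ht⟩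
      have hH₃ := hH₂.frame hF₃ rfl rfl rfl
      have e6₃ : σ₃.nat 6 = j := (hF₃.nat 6 rfl).trans e6
      have eA₃ : σ₃.natArr 0 = σ₁.natArr 0 := (hF₃.natArr 0 rfl).trans eA
      have eR₃ : σ₃.realArr 3 = σ₁.realArr 3 := (hF₃.realArr 3 rfl).trans eR
      have hall : ∀ k, j < k → k ≤ n → chord P j k ≤ chord P j (σ₁.natArr 0 (σ₃.nat 7)) := by
        rcases Nat.eq_zero_or_pos (σ₃.nat 7) with h0 | h0
        · rw [h0, hS0] at hmax ⊢
          exact hmax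
        · obtain ⟨m, hm⟩ : ∃ m, σ₃.nat 7 = m + 1 := ⟨σ₃.nat 7 - 1, by omega⟩
          obtain ⟨hdec, hms⟩ := hS m (by omega)
          simp only [BExpr.holds] at hcond
          rw [chordExpr_eval hH₃ (by simp [e6₃]; omega) (by simpa [eA₃] using hSn _ h7),
            chordExpr_eval hH₃ (by simpa [eA₃] using hSn _ h7)
              (by simpa [eA₃] using hSn _ (by omega))] at hcond
          simp [e6₃, eA₃, hm] at hcond
          rw [hm] at hmax hlt₃ ⊢
          exact chord_le_chord_of_stop hlt₃ hcond hmax hms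
      simp only [wp_storeReal]
      rw [chordExpr_eval hH₃ (by simp [e6₃]; omega) (by simpa [eA₃] using hSn _ h7)]
      simp [e6₃, eA₃, eR₃, chordExpr, hj'] at ht ⊢
      refine ⟨⟨by omega, hS0, ?_, ?_, ?_⟩, ?_⟩
      · intro m hm
        split_ifs with h'
        · omega
        · exact hSn m (by omega)
      · intro m hm
        by_cases h' : m = σ₃.nat 7
        · subst h'
          simpa using ⟨hlt₃, hall⟩
        · have h1 : m + 1 ≠ σ₃.nat 7 + 1 := by omega
          have h2 : m ≠ σ₃.nat 7 + 1 := by omega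
          simp only [h', h2, if_false]
          exact hS m (by omega)
      · intro i hi hi'
        split_ifs with h'
        · subst h'
          exact ⟨hall, .inr ⟨_, hlt₃, hSn _ h7, rfl⟩⟩
        · exact hr i (by omega) hi'
      · omega
  · rintro t σ₁ ⟨hF, ⟨hj, hS0, htop, hSn, hS, hr⟩, hlt, ht⟩
    simp [h.size] at ht hlt ⊢
    rw [hlt] at hr
    exact ⟨by omega, fun j hj => hr j (Nat.zero_le _) hj⟩

end PSEI

/-! ### Positive hit-support: scanning the lower convex hulls -/

namespace PSEI

open RealRAM

/-- The pair `(i, j)` maximizes `P b - P a - s (b - a)` over all `a`, `b` with `a + L ≤ b ≤ n`, with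
the smallest possible `j`, and with the largest possible `i` for this `j`. -/
structure Critical (n L : ℕ) (P : ℕ → ℝ) (s : ℝ) (i j : ℕ) : Prop where
  feasible : i + L ≤ j
  le : j ≤ n
  pos : 0 < s
  max : ∀ a b, a + L ≤ b → b ≤ n → P b - s * b - (P a - s * a) ≤ P j - s * j - (P i - s * i)
  first : ∀ a b, a + L ≤ b → b < j → P b - s * b - (P a - s * a) < P j - s * j - (P i - s * i)
  last : ∀ a, i < a → a + L ≤ j → P i - s * i < P a - s * a

/-- A largest positive eccentricity is attained at a critical pair: since the square root is
strictly concave, the line that touches the graph of `ℓ ↦ c √ℓ` at the optimal length `ℓ₀` lies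
above the graph elsewhere. So for its slope `s = h / (2 ℓ₀)`, all maximizers of
`P b - P a - s (b - a)` have the length `ℓ₀` and the optimal hit-support `h`. -/
theorem exists_critical {n L : ℕ} {P : ℕ → ℝ} (hL : 1 ≤ L) {i₀ j₀ : ℕ} (h₀ : i₀ + L ≤ j₀)
    (hn : j₀ ≤ n) (hpos : 0 < P j₀ - P i₀) :
    ∃ s i j, Critical n L P s i j ∧
      ∀ a b, a + L ≤ b → b ≤ n → diffEcc P a b ≤ diffEcc P i j := by
  have hfin : {p : ℕ × ℕ | p.1 + L ≤ p.2 ∧ p.2 ≤ n}.Finite := by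
    refine ((Set.finite_Iic n).prod (Set.finite_Iic n)).subset ?_
    rintro ⟨a, b⟩ ⟨h1, h2⟩
    exact ⟨by simp at *; omega, h2⟩
  obtain ⟨⟨a₁, b₁⟩, ⟨h1, h1n⟩, hmax⟩ := Set.exists_max_image _
    (fun p : ℕ × ℕ => diffEcc P p.1 p.2) hfin ⟨(i₀, j₀), h₀, hn⟩
  simp only at h1 h1n hmax
  replace hmax : ∀ a b, a + L ≤ b → b ≤ n → diffEcc P a b ≤ diffEcc P a₁ b₁ :=
    fun a b hab hb => hmax (a, b) ⟨hab, hb⟩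
  have hl : ∀ {a b : ℕ}, a + L ≤ b → (0 : ℝ) < b - a := fun {a b} hab => by
    rw [sub_pos]; exact_mod_cast (by omega : a < b)
  have hcast : ∀ {a b : ℕ}, a + L ≤ b → ((b - a : ℕ) : ℝ) = b - a := fun {a b} hab =>
    Nat.cast_sub (by omega)
  set c := diffEcc P a₁ b₁ with hc
  have hcpos : 0 < c := by
    refine lt_of_lt_of_le ?_ (hmax i₀ j₀ h₀ hn)
    exact div_pos hpos (Real.sqrt_pos.2 (by rw [hcast h₀]; exact hl h₀))
  set q := Real.sqrt (b₁ - a₁) with hq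
  have hqpos : 0 < q := Real.sqrt_pos.2 (hl h1)
  have hqq : q * q = b₁ - a₁ := Real.mul_self_sqrt (hl h1).le
  have hval : P b₁ - P a₁ = c * q := by
    rw [hc, diffEcc, hcast h1, ← hq]; field_simp
  set s := c / (2 * q) with hs
  have hsq : s * (2 * q) = c := by rw [hs]; field_simp
  have hspos : 0 < s := by positivity
  -- The excess over the maximum is at most `-s (√(b - a) - √ℓ₀)²`.
  have key : ∀ a b, a + L ≤ b → b ≤ n → P b - s * b - (P a - s * a) ≤
      P b₁ - s * b₁ - (P a₁ - s * a₁) - s * (Real.sqrt (b - a) - q) ^ 2 := by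
    intro a b hab hb
    have h2 := hmax a b hab hb
    rw [diffEcc, hcast hab, div_le_iff₀ (Real.sqrt_pos.2 (hl hab))] at h2
    have h3 : Real.sqrt (b - a) * Real.sqrt (b - a) = b - a := Real.mul_self_sqrt (hl hab).le
    set r := Real.sqrt ((b : ℝ) - a)
    have e1 : s * (b : ℝ) - s * a = s * (r * r) := by rw [h3]; ring
    have e2 : s * (b₁ : ℝ) - s * a₁ = s * (q * q) := by rw [hqq]; ring
    have e3 : c * r = 2 * (s * q * r) := by rw [← hsq]; ring
    have e4 : c * q = 2 * (s * q * q) := by rw [← hsq]; ring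
    nlinarith
  have key' : ∀ a b, a + L ≤ b → b ≤ n →
      P b - s * b - (P a - s * a) ≤ P b₁ - s * b₁ - (P a₁ - s * a₁) := fun a b hab hb =>
    (key a b hab hb).trans (sub_le_self _ (by positivity))
  have hlen : ∀ a b, a + L ≤ b → b ≤ n →
      P b - s * b - (P a - s * a) = P b₁ - s * b₁ - (P a₁ - s * a₁) → b - a = b₁ - a₁ := by
    intro a b hab hb he
    have h2 := key a b hab hb
    rw [he] at h2
    have h3 : (Real.sqrt (b - a) - q) ^ 2 = 0 := by
      refine le_antisymm ?_ (sq_nonneg _)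
      by_contra! hlt
      nlinarith [mul_pos hspos hlt]
    have h4 : Real.sqrt (b - a) = q := sub_eq_zero.1 (pow_eq_zero_iff two_ne_zero |>.1 h3)
    rw [hq, Real.sqrt_inj (hl hab).le (hl h1).le, ← hcast hab, ← hcast h1] at h4
    exact_mod_cast h4
  classical
  have hex : ∃ j, ∃ i, i + L ≤ j ∧ j ≤ n ∧
      P j - s * j - (P i - s * i) = P b₁ - s * b₁ - (P a₁ - s * a₁) := ⟨b₁, a₁, h1, h1n, rfl⟩
  obtain ⟨i, hij, hj, he⟩ := Nat.find_spec hex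
  have hjmin := fun m => Nat.find_min hex (m := m)
  set j := Nat.find hex
  refine ⟨s, i, j, ⟨hij, hj, hspos, fun a b hab hb => he ▸ key' a b hab hb, ?_, ?_⟩, ?_⟩
  · intro a b hab hb
    refine lt_of_le_of_ne (he ▸ key' a b hab (by omega)) fun h => ?_
    exact hjmin b hb ⟨a, hab, by omega, h.trans he⟩
  · intro a ha haj
    by_contra! hle
    have h3 := key' a j haj hj
    have h4 := hlen a j haj hj (by linarith)
    have h5 := hlen i j hij hj he
    omega
  · have h5 := hlen i j hij hj he
    have e1 : (j : ℝ) - i = b₁ - a₁ := by rw [← hcast hij, ← hcast h1, h5]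
    have : diffEcc P i j = c := by
      rw [hc, diffEcc, diffEcc, h5]
      congr 1
      have : s * (j : ℝ) - s * i = s * b₁ - s * a₁ := by rw [← mul_sub, e1, mul_sub]
      linarith
    intro a b hab hb
    rw [this]
    exact hmax a b hab hb

namespace Critical

variable {n L : ℕ} {P : ℕ → ℝ} {s : ℝ} {i j : ℕ}

theorem chord_le (h : Critical n L P s i j) {u : ℕ} (hu : u < i) : chord P u i ≤ s := by
  rw [chord_le_iff hu]
  linarith [h.max u j (by have := h.feasible; omega) h.le]

theorem le_chord (h : Critical n L P s i j) {v : ℕ} (hv : i < v) (hvj : v + L ≤ j) :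
    s < chord P i v := by
  rw [← not_le, chord_le_iff hv, not_le]
  exact h.last v hv hvj

/-- The start of the critical pair is a vertex of the lower hull. -/
theorem not_chord_le (h : Critical n L P s i j) {u v : ℕ} (hu : u < i) (hv : i < v)
    (hvj : v + L ≤ j) : ¬ chord P i v ≤ chord P u i := fun hle =>
  absurd ((h.le_chord hv hvj).trans_le (hle.trans (h.chord_le hu))) (lt_irrefl _)

/-- The start of the critical pair is not discarded when the scan for an earlier end is done. -/
theorem not_rightSlope_le (h : Critical n L P s i j) {u b : ℕ} {r : ℝ} (hu : u < i)
    (hib : i + L ≤ b) (hb : b < j) (hr : IsRightSlope n P b r) : ¬ r ≤ chord P u i := fun hle => by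
  have h1 := (chord_le_iff hb).1 ((hr.1 j hb h.le).trans (hle.trans (h.chord_le hu)))
  linarith [h.first i b hib hb]

theorem rightSlope_le (h : Critical n L P s i j) {r : ℝ} (hr : IsRightSlope n P j r) : r ≤ s := by
  rcases hr.2 with rfl | ⟨k, hk, hkn, rfl⟩
  · exact h.pos.le
  · rw [chord_le_iff hk]
    linarith [h.max i k (by have := h.feasible; omega) hkn]

end Critical

/-- Compares the interval given by the top of the stack and the register `6` with the best interval
found so far, which is given by the registers `4` and `5` and has the eccentricity in the real
register `1`. -/
def evaluate : Prog :=
  .seq (.setReal 2 (.div (.sub (.get 2 (.reg 6)) (.get 2 (.get 0 (.reg 7))))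
    (.sqrt (.ofNat (.sub (.reg 6) (.get 0 (.reg 7))))))) <|
  .ite (.realLe (.reg 1) (.reg 2))
    (.seq (.setReal 1 (.reg 2)) (.seq (.setNat 4 (.get 0 (.reg 7))) (.setNat 5 (.reg 6)))) .skip

/-- The registers `4` and `5` hold an interval, and the real register `1` its eccentricity. -/
structure HoldsBest (n L : ℕ) (P : ℕ → ℝ) (σ : State) : Prop where
  feasible : σ.nat 4 + L ≤ σ.nat 5
  le : σ.nat 5 ≤ n
  value : σ.real 1 = diffEcc P (σ.nat 4) (σ.nat 5)

theorem evaluate_spec {n L : ℕ} {P : ℕ → ℝ} {σ : State} (h : HoldsSums n L P σ)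
    (hb : HoldsBest n L P σ) (h₁ : σ.natArr 0 (σ.nat 7) + L ≤ σ.nat 6) (h₂ : σ.nat 6 ≤ n) :
    Wp evaluate (fun t σ' => t ≤ 40 ∧ HoldsBest n L P σ' ∧ σ.real 1 ≤ σ'.real 1 ∧
      diffEcc P (σ.natArr 0 (σ.nat 7)) (σ.nat 6) ≤ σ'.real 1) σ := by
  have e : (P (σ.nat 6) - P (σ.natArr 0 (σ.nat 7))) /
      Real.sqrt ((σ.nat 6 - σ.natArr 0 (σ.nat 7) : ℕ) : ℝ) =
      diffEcc P (σ.natArr 0 (σ.nat 7)) (σ.nat 6) := rfl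
  simp [evaluate, h.sums _ h₂, h.sums (σ.natArr 0 (σ.nat 7)) (by omega), e]
  exact ⟨fun hle => ⟨⟨by simpa using h₁, by simpa using h₂, by simp⟩, hle⟩,
    fun hlt => ⟨⟨hb.feasible, hb.le, by simpa using hb.value⟩, hlt.le⟩⟩

/-- Computes, in the integer registers `4` and `5`, an interval of largest eccentricity, if these
registers initially hold an interval of positive hit-support. The register `6` runs through the ends
`j`. The integer array `0` is a stack, with its top at the position given by the register `7`, that
holds vertices of the lower convex hull of the points up to `j - L`; with each end `j`, those starts
are tried, and except for the last one discarded, at which the hull has a larger slope than all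
chords from `j` to later points. -/
def scanHulls : Prog :=
  .seq (.storeNat 0 (.const 0) (.const 0)) <|
  .seq (.setNat 7 (.const 0)) <|
  .seq (.setNat 6 (.reg 1)) <|
  .seq (.setReal 1 (.div (.sub (.get 2 (.reg 5)) (.get 2 (.reg 4)))
    (.sqrt (.ofNat (.sub (.reg 5) (.reg 4)))))) <|
  .while (.natLe (.reg 6) (.reg 0)) <|
    .seq evaluate <|
    .seq (.while (.and (.natLe (.const 1) (.reg 7)) (.realLe (.get 3 (.reg 6))
        (chordExpr (.get 0 (.sub (.reg 7) (.const 1))) (.get 0 (.reg 7)))))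
      (.seq (.setNat 7 (.sub (.reg 7) (.const 1))) evaluate)) <|
    .seq (.setNat 6 (.add (.reg 6) (.const 1))) <|
    .seq (.while (.and (.natLe (.const 1) (.reg 7))
        (.realLe (chordExpr (.get 0 (.reg 7)) (.sub (.reg 6) (.reg 1)))
          (chordExpr (.get 0 (.sub (.reg 7) (.const 1))) (.get 0 (.reg 7)))))
      (.setNat 7 (.sub (.reg 7) (.const 1)))) <|
    .seq (.setNat 7 (.add (.reg 7) (.const 1))) <|
    .storeNat 0 (.reg 7) (.sub (.reg 6) (.reg 1))

/-- The entries `0, …, m` of `S` are indices, in increasing order, of at most `v`, such that the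
slopes of the chords between consecutive ones do not decrease. -/
structure IsHullStack (P : ℕ → ℝ) (S : ℕ → ℕ) (m v : ℕ) : Prop where
  lt : ∀ a < m, S a < S (a + 1)
  le : ∀ a ≤ m, S a ≤ v
  chord_le : ∀ a b, a ≤ b → b < m → chord P (S a) (S (a + 1)) ≤ chord P (S b) (S (b + 1))

theorem IsHullStack.mono {P : ℕ → ℝ} {S : ℕ → ℕ} {m m' v v' : ℕ} (h : IsHullStack P S m v)
    (hm : m' ≤ m) (hv : v ≤ v') : IsHullStack P S m' v' :=
  ⟨fun a ha => h.lt a (by omega), fun a ha => (h.le a (by omega)).trans hv,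
    fun a b hab hb => h.chord_le a b hab (by omega)⟩

theorem IsHullStack.push {P : ℕ → ℝ} {S S' : ℕ → ℕ} {m v v' : ℕ} (h : IsHullStack P S m v)
    (hS : ∀ a ≤ m, S' a = S a) (hv : S' (m + 1) = v') (hvv : v < v')
    (hc : ∀ a, a + 1 = m → chord P (S a) (S m) ≤ chord P (S m) v') :
    IsHullStack P S' (m + 1) v' := by
  refine ⟨fun a ha => ?_, fun a ha => ?_, fun a b hab hb => ?_⟩
  · rcases Nat.lt_succ_iff_lt_or_eq.1 ha with h' | rfl
    · rw [hS a h'.le, hS (a + 1) h']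
      exact h.lt a h'
    · rw [hS a le_rfl, hv]
      exact (h.le a le_rfl).trans_lt hvv
  · rcases Nat.le_succ_iff.1 ha with h' | rfl
    · rw [hS a h']
      exact (h.le a h').trans hvv.le
    · rw [hv]
  · rcases Nat.lt_succ_iff_lt_or_eq.1 hb with h' | rfl
    · rw [hS a (by omega), hS (a + 1) (by omega), hS b (by omega), hS (b + 1) (by omega)]
      exact h.chord_le a b hab h'
    · rcases hab.eq_or_lt with rfl | hab
      · exact le_rfl
      · rw [hS a (by omega), hS (a + 1) (by omega), hS b le_rfl, hv]
        refine (h.chord_le a (b - 1) (by omega) (by omega)).trans ?_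
        rw [Nat.sub_add_cancel (by omega)]
        exact hc (b - 1) (by omega)

end PSEI

namespace PSEI

open RealRAM

/-- The scan for the end `σ.nat 6` of a critical pair reaches the start of the pair. -/
theorem scanLoop_spec {n L : ℕ} {P : ℕ → ℝ} {s : ℝ} {i j : ℕ} (hc : Critical n L P s i j)
    {σ : State} (h : HoldsSums n L P σ) (hb : HoldsBest n L P σ) (hL : L ≤ σ.nat 6)
    (hn : σ.nat 6 ≤ n)
    (hS : IsHullStack P (σ.natArr 0) (σ.nat 7) (σ.nat 6 - L))
    (hr : IsRightSlope n P (σ.nat 6) (σ.realArr 3 (σ.nat 6)))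
    (hi : i + L ≤ σ.nat 6 → σ.nat 6 ≤ j → ∃ m ≤ σ.nat 7, σ.natArr 0 m = i)
    (hbest : σ.nat 6 = j → diffEcc P i j ≤ σ.real 1 ∨ ∃ m < σ.nat 7, σ.natArr 0 m = i)
    (hdone : j < σ.nat 6 → diffEcc P i j ≤ σ.real 1) :
    Wp (.while (.and (.natLe (.const 1) (.reg 7)) (.realLe (.get 3 (.reg 6))
        (chordExpr (.get 0 (.sub (.reg 7) (.const 1))) (.get 0 (.reg 7)))))
      (.seq (.setNat 7 (.sub (.reg 7) (.const 1))) evaluate))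
    (fun t σ' => σ'.nat 6 = σ.nat 6 ∧ σ'.natArr 0 = σ.natArr 0 ∧ σ'.realArr 3 = σ.realArr 3 ∧
      HoldsSums n L P σ' ∧ HoldsBest n L P σ' ∧
      σ'.nat 7 ≤ σ.nat 7 ∧
      (i + L ≤ σ.nat 6 → σ.nat 6 < j → ∃ m ≤ σ'.nat 7, σ.natArr 0 m = i) ∧
      (j ≤ σ.nat 6 → diffEcc P i j ≤ σ'.real 1) ∧
      t + 100 * σ'.nat 7 ≤ 100 * σ.nat 7 + 40) σ := by
  refine (wp_while (fun σ' => HoldsBest n L P σ' ∧ σ'.nat 7 ≤ σ.nat 7 ∧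
    (i + L ≤ σ.nat 6 → σ.nat 6 < j → ∃ m ≤ σ'.nat 7, σ.natArr 0 m = i) ∧
    (σ.nat 6 = j → diffEcc P i j ≤ σ'.real 1 ∨ ∃ m < σ'.nat 7, σ.natArr 0 m = i) ∧
    (j < σ.nat 6 → diffEcc P i j ≤ σ'.real 1)) (fun σ => 100 * σ.nat 7) ?_ ?_).mono ?_
  · exact ⟨hb, le_rfl, fun h1 h2 => hi h1 h2.le, hbest, hdone⟩
  · intro σ₁ hF ⟨hb₁, h7, hi₁, hbest₁, hdone₁⟩ ⟨hsp, hcond⟩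
    have hH₁ := h.frame hF rfl rfl rfl
    have e6 : σ₁.nat 6 = σ.nat 6 := hF.nat 6 rfl
    have eA : σ₁.natArr 0 = σ.natArr 0 := hF.natArr 0 rfl
    have eR : σ₁.realArr 3 = σ.realArr 3 := hF.realArr 3 rfl
    obtain ⟨m, hm⟩ : ∃ m, σ₁.nat 7 = m + 1 := by
      simp at hsp
      exact ⟨σ₁.nat 7 - 1, by omega⟩
    have hSm := hS.le m (by omega)
    have hSm' := hS.le (m + 1) (by omega)
    simp only [BExpr.holds] at hcond
    rw [chordExpr_eval hH₁ (by simp [eA, hm]; omega) (by simp [eA, hm]; omega)] at hcond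
    simp [eA, hm, eR, e6] at hcond
    simp only [wp_seq, wp_setNat]
    set σ₂ := σ₁.setNat 7 (NExpr.eval σ₁ (.sub (.reg 7) (.const 1))) with hσ₂
    have e7₂ : σ₂.nat 7 = m := by simp [hσ₂, hm]
    have e6₂ : σ₂.nat 6 = σ.nat 6 := by simp [hσ₂, e6]
    have eA₂ : σ₂.natArr 0 = σ.natArr 0 := by simp [hσ₂, eA]
    have e1₂ : σ₂.real 1 = σ₁.real 1 := by simp [hσ₂]
    have hH₂ : HoldsSums n L P σ₂ := ⟨by simp [hσ₂, hH₁.size], by simp [hσ₂, hH₁.bound],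
      by simpa [hσ₂] using hH₁.sums⟩
    have hb₂ : HoldsBest n L P σ₂ := ⟨by simpa [hσ₂] using hb₁.feasible,
      by simpa [hσ₂] using hb₁.le, by simpa [hσ₂] using hb₁.value⟩
    clear_value σ₂
    refine (evaluate_spec hH₂ hb₂ (by rw [eA₂, e7₂, e6₂]; omega) (by rw [e6₂]; omega)).frame.mono ?_
    rintro t σ₃ ⟨hF₃, ht, hb₃, hle, hval⟩
    have e7₃ : σ₃.nat 7 = m := (hF₃.nat 7 rfl).trans e7₂
    rw [e1₂] at hle
    rw [eA₂, e7₂, e6₂] at hval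
    refine ⟨⟨hb₃, by omega, ?_, ?_, fun h' => (hdone₁ h').trans hle⟩, ?_⟩
    · intro h1 h2
      obtain ⟨m', hm', rfl⟩ := hi₁ h1 h2
      refine ⟨m', ?_, rfl⟩
      rcases (hm ▸ hm' : m' ≤ m + 1).eq_or_lt with rfl | hlt
      · exact absurd hcond (hc.not_rightSlope_le (hS.lt m (by omega)) h1 h2 hr)
      · omega
    · intro h1
      rcases hbest₁ h1 with h2 | ⟨m', hm', rfl⟩
      · exact .inl (h2.trans hle)
      · rcases (show m' ≤ m by omega).eq_or_lt with rfl | hlt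
        · exact .inl (h1 ▸ hval)
        · exact .inr ⟨m', by omega, rfl⟩
    · simp [chordExpr, e7₃, hm]
      omega
  · rintro t σ₁ ⟨hF, ⟨hb₁, h7, hi₁, hbest₁, hdone₁⟩, hcond, ht⟩
    have hH₁ := h.frame hF rfl rfl rfl
    have e6 : σ₁.nat 6 = σ.nat 6 := hF.nat 6 rfl
    have eA : σ₁.natArr 0 = σ.natArr 0 := hF.natArr 0 rfl
    have eR : σ₁.realArr 3 = σ.realArr 3 := hF.realArr 3 rfl
    refine ⟨e6, eA, eR, hH₁, hb₁, h7, hi₁, fun hj => ?_, ?_⟩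
    · rcases hj.eq_or_lt with hj | hj
      · rcases hbest₁ hj.symm with h1 | ⟨m, hm, rfl⟩
        · exact h1
        exfalso
        obtain ⟨m', hm'⟩ : ∃ m', σ₁.nat 7 = m' + 1 := ⟨σ₁.nat 7 - 1, by omega⟩
        have hSm := hS.le m' (by omega)
        have hSm' := hS.le (m' + 1) (by omega)
        have hSm₁ := hS.le (m + 1) (by omega)
        simp only [BExpr.holds] at hcond
        rw [chordExpr_eval hH₁ (by simp [eA, hm']; omega) (by simp [eA, hm']; omega)] at hcond
        simp [eA, hm', eR, e6] at hcond
        have h1 := hc.rightSlope_le (hj ▸ hr : IsRightSlope n P j _)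
        have h2 := hc.le_chord (hS.lt m (by omega)) (by omega)
        have h3 := hS.chord_le m m' (by omega) (by omega)
        rw [← hj] at hcond
        linarith
      · exact hdone₁ hj
    · simp [chordExpr] at ht
      omega

/-- Points that are not vertices of the lower hull after the arrival of a new point are discarded;
the start of a critical pair is not among them. -/
theorem popLoop_spec {n L : ℕ} {P : ℕ → ℝ} {s : ℝ} {i j : ℕ} (hc : Critical n L P s i j)
    {σ : State} (h : HoldsSums n L P σ) (hL : L < σ.nat 6) (hL1 : 1 ≤ L)
    (hn : σ.nat 6 ≤ n + 1)
    (hS : IsHullStack P (σ.natArr 0) (σ.nat 7) (σ.nat 6 - L - 1))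
    (hi : i + L < σ.nat 6 → σ.nat 6 ≤ j → ∃ m ≤ σ.nat 7, σ.natArr 0 m = i) :
    Wp (.while (.and (.natLe (.const 1) (.reg 7))
        (.realLe (chordExpr (.get 0 (.reg 7)) (.sub (.reg 6) (.reg 1)))
          (chordExpr (.get 0 (.sub (.reg 7) (.const 1))) (.get 0 (.reg 7)))))
      (.setNat 7 (.sub (.reg 7) (.const 1))))
    (fun t σ' => Frame (.setNat 7 (.const 0)) σ σ' ∧ σ'.nat 7 ≤ σ.nat 7 ∧
      (i + L < σ.nat 6 → σ.nat 6 ≤ j → ∃ m ≤ σ'.nat 7, σ.natArr 0 m = i) ∧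
      (∀ a, a + 1 = σ'.nat 7 → chord P (σ.natArr 0 a) (σ.natArr 0 (a + 1)) ≤
        chord P (σ.natArr 0 (a + 1)) (σ.nat 6 - L)) ∧
      t + 100 * σ'.nat 7 ≤ 100 * σ.nat 7 + 40) σ := by
  refine (wp_while (fun σ' => σ'.nat 7 ≤ σ.nat 7 ∧
    (i + L < σ.nat 6 → σ.nat 6 ≤ j → ∃ m ≤ σ'.nat 7, σ.natArr 0 m = i))
    (fun σ => 100 * σ.nat 7) ⟨le_rfl, hi⟩ ?_).mono ?_
  · intro σ₁ hF ⟨h7, hi₁⟩ ⟨hsp, hcond⟩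
    have hH₁ := h.frame hF rfl rfl rfl
    have e6 : σ₁.nat 6 = σ.nat 6 := hF.nat 6 rfl
    have eA : σ₁.natArr 0 = σ.natArr 0 := hF.natArr 0 rfl
    have e1 : σ₁.nat 1 = L := hH₁.bound
    obtain ⟨m, hm⟩ : ∃ m, σ₁.nat 7 = m + 1 := by
      simp at hsp
      exact ⟨σ₁.nat 7 - 1, by omega⟩
    have hSm := hS.le m (by omega)
    have hSm' := hS.le (m + 1) (by omega)
    simp only [BExpr.holds] at hcond
    rw [chordExpr_eval hH₁ (by simp [eA, hm]; omega) (by simp [e6, e1]; omega),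
      chordExpr_eval hH₁ (by simp [eA, hm]; omega) (by simp [eA, hm]; omega)] at hcond
    simp [eA, hm, e6, e1] at hcond
    simp [hm, chordExpr]
    refine ⟨⟨by omega, fun h1 h2 => ?_⟩, by omega⟩
    obtain ⟨m', hm', rfl⟩ := hi₁ h1 h2
    refine ⟨m', ?_, rfl⟩
    rcases (hm ▸ hm' : m' ≤ m + 1).eq_or_lt with rfl | hlt
    · exact absurd hcond (hc.not_chord_le (hS.lt m (by omega)) (by omega) (by omega))
    · omega
  · rintro t σ₁ ⟨hF, ⟨h7, hi₁⟩, hcond, ht⟩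
    have hH₁ := h.frame hF rfl rfl rfl
    have e6 : σ₁.nat 6 = σ.nat 6 := hF.nat 6 rfl
    have eA : σ₁.natArr 0 = σ.natArr 0 := hF.natArr 0 rfl
    have e1 : σ₁.nat 1 = L := hH₁.bound
    refine ⟨⟨hF.nat, hF.real, hF.natArr, hF.realArr⟩, h7, hi₁, fun m hm => ?_, ?_⟩
    · have hSm := hS.le m (by omega)
      have hSm' := hS.le (m + 1) (by omega)
      simp only [BExpr.holds] at hcond
      rw [chordExpr_eval hH₁ (by simp [eA, ← hm]; omega) (by simp [e6, e1]; omega),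
        chordExpr_eval hH₁ (by simp [eA, ← hm]; omega) (by simp [eA, ← hm]; omega)] at hcond
      simp [eA, ← hm, e6, e1] at hcond
      exact hcond.le
    · simp [chordExpr] at ht
      omega

theorem scanHulls_spec {n L : ℕ} {P : ℕ → ℝ} {σ : State} (h : HoldsSums n L P σ) (hL : 1 ≤ L)
    (h₁ : σ.nat 4 + L ≤ σ.nat 5) (h₂ : σ.nat 5 ≤ n) (hpos : 0 < P (σ.nat 5) - P (σ.nat 4))
    (hr : ∀ j ≤ n, IsRightSlope n P j (σ.realArr 3 j)) :
    Wp scanHulls (fun t σ' => t ≤ 600 * (n + 1) ∧ σ'.nat 4 + L ≤ σ'.nat 5 ∧ σ'.nat 5 ≤ n ∧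
      ∀ a b, a + L ≤ b → b ≤ n → diffEcc P a b ≤ diffEcc P (σ'.nat 4) (σ'.nat 5)) σ := by
  obtain ⟨s, i, j, hc, hopt⟩ := exists_critical hL h₁ h₂ hpos
  simp only [scanHulls, wp_seq, wp_setNat, wp_storeNat, wp_setReal]
  refine (wp_while (fun σ => HoldsBest n L P σ ∧ L ≤ σ.nat 6 ∧ σ.nat 6 ≤ n + 1 ∧
    IsHullStack P (σ.natArr 0) (σ.nat 7) (σ.nat 6 - L) ∧
    (i + L ≤ σ.nat 6 → σ.nat 6 ≤ j → ∃ m ≤ σ.nat 7, σ.natArr 0 m = i) ∧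
    (j < σ.nat 6 → diffEcc P i j ≤ σ.real 1))
    (fun σ => 500 * (n + 1 - σ.nat 6) + 100 * σ.nat 7) ?_ ?_).mono ?_
  · refine ⟨⟨by simpa using h₁, by simpa using h₂, ?_⟩, ?_, ?_, ?_, ?_, ?_⟩
    · simp [h.sums _ h₂, h.sums (σ.nat 4) (by omega), diffEcc]
    · simp [h.bound]
    · simp [h.bound]; omega
    · simp [h.bound]
      exact ⟨fun a ha => absurd ha (by omega), fun a ha => by simp [Nat.le_zero.1 ha],
        fun a b _ hb => absurd hb (by omega)⟩
    · simp [h.bound]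
      omega
    · have := hc.feasible
      simp [h.bound]
      omega
  · intro σ₁ hF ⟨hb, hL₁, hn₁, hS, hi, hdone⟩ hlt
    have hH : HoldsSums n L P σ₁ := by
      refine ⟨(hF.nat 0 rfl).trans (by simpa using h.size),
        (hF.nat 1 rfl).trans (by simpa using h.bound), fun k hk => ?_⟩
      rw [hF.realArr 2 rfl]
      simpa using h.sums k hk
    have hR : ∀ j ≤ n, IsRightSlope n P j (σ₁.realArr 3 j) := by
      rw [hF.realArr 3 rfl]
      simpa using hr
    simp [hH.size] at hlt
    have htop := hS.le (σ₁.nat 7) le_rfl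
    simp only [wp_seq]
    refine (evaluate_spec hH hb (by omega) hlt).frame.mono ?_
    rintro t₂ σ₂ ⟨hF₂, ht₂, hb₂, hle₂, hval₂⟩
    have hH₂ := hH.frame hF₂ rfl rfl rfl
    have e6₂ : σ₂.nat 6 = σ₁.nat 6 := hF₂.nat 6 rfl
    have e7₂ : σ₂.nat 7 = σ₁.nat 7 := hF₂.nat 7 rfl
    have eA₂ : σ₂.natArr 0 = σ₁.natArr 0 := hF₂.natArr 0 rfl
    have eR₂ : σ₂.realArr 3 = σ₁.realArr 3 := hF₂.realArr 3 rfl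
    refine (scanLoop_spec hc hH₂ hb₂ (by omega) (by omega) (by rwa [eA₂, e7₂, e6₂])
      (by rw [eR₂, e6₂]; exact hR _ hlt) (by rwa [eA₂, e7₂, e6₂]) ?_
      (by rw [e6₂]; exact fun h => (hdone h).trans hle₂)).mono ?_
    · rw [e6₂, eA₂, e7₂]
      intro hj
      obtain ⟨m, hm, rfl⟩ := hi (hj ▸ hc.feasible) hj.le
      rcases hm.eq_or_lt with rfl | hm
      · rw [hj] at hval₂
        exact .inl hval₂
      · exact .inr ⟨m, hm, rfl⟩
    rintro t₃ σ₃ ⟨e6₃, eA₃, eR₃, hH₃, hb₃, h7₃, hi₃, hdone₃, ht₃⟩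
    rw [e6₂] at hi₃ hdone₃ e6₃
    rw [eA₂] at hi₃ eA₃
    simp only [wp_setNat]
    set σ₄ := σ₃.setNat 6 (NExpr.eval σ₃ (.add (.reg 6) (.const 1))) with hσ₄
    have e7₄ : σ₄.nat 7 = σ₃.nat 7 := by simp [hσ₄]
    have e6₄ : σ₄.nat 6 = σ₁.nat 6 + 1 := by simp [hσ₄, e6₃]
    have eA₄ : σ₄.natArr 0 = σ₁.natArr 0 := by simp [hσ₄, eA₃]
    have e1₄ : σ₄.real 1 = σ₃.real 1 := by simp [hσ₄]
    have hH₄ : HoldsSums n L P σ₄ := ⟨by simp [hσ₄, hH₃.size], by simp [hσ₄, hH₃.bound],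
      by simpa [hσ₄] using hH₃.sums⟩
    have hb₄ : HoldsBest n L P σ₄ := ⟨by simpa [hσ₄] using hb₃.feasible,
      by simpa [hσ₄] using hb₃.le, by simpa [hσ₄] using hb₃.value⟩
    clear_value σ₄
    have hS₄ : IsHullStack P (σ₄.natArr 0) (σ₄.nat 7) (σ₄.nat 6 - L - 1) := by
      rw [eA₄, e7₄, e6₄, show σ₁.nat 6 + 1 - L - 1 = σ₁.nat 6 - L by clear hi hi₃; omega]
      exact hS.mono (by clear hi hi₃; omega) le_rfl
    refine (popLoop_spec hc hH₄ (by omega) hL (by omega) hS₄ ?_).mono ?_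
    · rw [e6₄, eA₄, e7₄]
      exact fun h1 h2 => hi₃ (by omega) (by omega)
    rintro t₅ σ₅ ⟨hF₅, h7₅, hi₅, hchord, ht₅⟩
    have hH₅ := hH₄.frame hF₅ rfl rfl rfl
    have e6₅ : σ₅.nat 6 = σ₁.nat 6 + 1 := (hF₅.nat 6 rfl).trans e6₄
    have e4₅ : σ₅.nat 4 = σ₄.nat 4 := hF₅.nat 4 rfl
    have e5₅ : σ₅.nat 5 = σ₄.nat 5 := hF₅.nat 5 rfl
    have e1₅ : σ₅.real 1 = σ₄.real 1 := hF₅.real 1 rfl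
    have eA₅ : σ₅.natArr 0 = σ₁.natArr 0 := (hF₅.natArr 0 rfl).trans eA₄
    rw [e6₄, eA₄] at hi₅ hchord
    simp only [wp_storeNat]
    refine ⟨⟨⟨?_, ?_, ?_⟩, ?_, ?_, ?_, ?_, ?_⟩, ?_⟩
    · simpa [e4₅, e5₅] using hb₄.feasible
    · simpa [e5₅] using hb₄.le
    · simpa [e4₅, e5₅, e1₅] using hb₄.value
    · simp [e6₅]; omega
    · simp [e6₅]; omega
    · have hle : σ₅.nat 7 ≤ σ₁.nat 7 := by clear hi hi₃ hi₅; omega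
      have hlt' : σ₁.nat 6 - L < σ₁.nat 6 + 1 - L := by clear hi hi₃ hi₅; omega
      simp only [State.nat_storeNat, State.nat_setNat, NExpr.eval, e6₅, hH₅.bound]
      refine (hS.mono hle le_rfl).push (fun a ha => ?_) ?_ hlt' fun a ha => ?_
      · have : a ≠ σ₅.nat 7 + 1 := by clear hi hi₃ hi₅; omega
        simp [eA₅, this]
      · simp
      · have := hchord a ha
        rwa [ha] at this
    · simp [e6₅, eA₅, hH₅.bound]
      intro h1 h2
      rcases h1.eq_or_lt with h1 | h1
      · exact ⟨σ₅.nat 7 + 1, le_rfl, by simp; omega⟩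
      · obtain ⟨m, hm, rfl⟩ := hi₅ h1 h2
        have : m ≠ σ₅.nat 7 + 1 := by omega
        exact ⟨m, by omega, by simp [this]⟩
    · simp [e6₅, e1₅, e1₄]
      exact fun h1 => hdone₃ (by omega)
    · simp [e6₅]
      omega
  · rintro t σ₁ ⟨hF, ⟨hb, hL₁, hn₁, hS, hi, hdone⟩, hlt, ht⟩
    have e0 : σ₁.nat 0 = n := (hF.nat 0 rfl).trans (by simpa using h.size)
    simp [e0, h.bound] at hlt ht ⊢
    refine ⟨by omega, hb.feasible, hb.le, fun a b hab hbn => ?_⟩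
    rw [← hb.value]
    exact (hopt a b hab hbn).trans (hdone (hc.le.trans_lt hlt))

end PSEI

/-! ### Negative hit-support: min-plus products -/

namespace PSEI

open RealRAM

/-- Computes `⌈√L⌉` and its square, in the integer registers `10` and `11`. -/
def ceilSqrt : Prog :=
  .seq (.setNat 10 (.const 0)) <|
  .seq (.setNat 11 (.const 0)) <|
  .while (.natLe (.add (.reg 11) (.const 1)) (.reg 1)) <|
    .seq (.setNat 11 (.add (.add (.reg 11) (.add (.reg 10) (.reg 10))) (.const 1))) <|
    .setNat 10 (.add (.reg 10) (.const 1))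

theorem ceilSqrt_spec {L : ℕ} {σ : State} (h : σ.nat 1 = L) :
    Wp ceilSqrt (fun t σ' => t ≤ 60 * (L + 1) ∧ σ'.nat 10 = ⌈Real.sqrt L⌉₊ ∧
      σ'.nat 11 = σ'.nat 10 * σ'.nat 10 ∧ L ≤ σ'.nat 11) σ := by
  simp only [ceilSqrt, wp_seq, wp_setNat]
  refine (wp_while (fun σ => σ.nat 11 = σ.nat 10 * σ.nat 10 ∧
    ∀ m < σ.nat 10, m * m < L) (fun σ => 40 * (L - σ.nat 10)) ?_ ?_).mono ?_
  · simp
  · intro σ₁ hF ⟨hsq, hlow⟩ hlt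
    have e1 : σ₁.nat 1 = L := (hF.nat 1 rfl).trans (by simpa using h)
    simp [e1] at hlt
    have : σ₁.nat 10 ≤ σ₁.nat 10 * σ₁.nat 10 := Nat.le_mul_self _
    simp [hsq]
    refine ⟨⟨by ring, fun m hm => ?_⟩, by omega⟩
    rcases hm.lt_or_eq with h | rfl
    · exact hlow m h
    · omega
  · rintro t σ₁ ⟨hF, ⟨hsq, hlow⟩, hlt, ht⟩
    have e1 : σ₁.nat 1 = L := (hF.nat 1 rfl).trans (by simpa using h)
    simp [e1] at hlt ht ⊢
    refine ⟨by omega, le_antisymm ?_ ?_, hsq, hlt⟩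
    · by_contra! hcon
      have h2 := hlow _ hcon
      have h4 : (L : ℝ) ≤ (⌈Real.sqrt L⌉₊ : ℝ) ^ 2 := by
        rw [← Real.sqrt_le_left (by positivity)]
        exact Nat.le_ceil _
      have h5 : ((⌈Real.sqrt L⌉₊ : ℝ)) ^ 2 < L := by
        rw [sq]
        exact_mod_cast h2
      linarith
    · refine Nat.ceil_le.2 (Real.sqrt_le_iff.2 ⟨by positivity, ?_⟩)
      rw [sq]
      exact_mod_cast hsq ▸ hlt

/-- The entries of the first factor: prefix sums, continued by `0`. -/
noncomputable def padLeft (n : ℕ) (P : ℕ → ℝ) (k : ℕ) : ℝ := if k ≤ n then P k else 0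

/-- The entries of the second factor: negated prefix sums, continued by a large number `C`. -/
noncomputable def padRight (n : ℕ) (P : ℕ → ℝ) (C : ℝ) (k : ℕ) : ℝ := if k ≤ n then -P k else C

/-- Fills the factors of a min-plus product. With `d`, `s` and `g` in the registers `10`, `12` and
`13`, the first one has the entry `P (s + x d + y)` in row `x` and column `y`, the second one has
the entry `-P (s + g + r + y)` in row `y` and column `r`. The large number is in the real register
`5`. -/
def fillFactors : Prog :=
  .seq (.setNat 14 (.const 0)) <|
  .seq (.setNat 15 (.const 0)) <|
  .seq (.setNat 16 (.const 0)) <|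
  .while (.natLe (.add (.reg 14) (.const 1)) (.reg 11)) <|
    .seq (.ite (.natLe (.add (.reg 12) (.reg 14)) (.reg 0))
      (.storeReal 100 (.reg 14) (.get 2 (.add (.reg 12) (.reg 14))))
      (.storeReal 100 (.reg 14) (.ofNat (.const 0)))) <|
    .seq (.setNat 19 (.add (.add (.add (.reg 12) (.reg 13)) (.reg 16)) (.reg 15))) <|
    .seq (.ite (.natLe (.reg 19) (.reg 0))
      (.storeReal 101 (.reg 14) (.sub (.ofNat (.const 0)) (.get 2 (.reg 19))))
      (.storeReal 101 (.reg 14) (.reg 5))) <|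
    .seq (.setNat 14 (.add (.reg 14) (.const 1))) <|
    .seq (.setNat 16 (.add (.reg 16) (.const 1))) <|
    .ite (.natLe (.reg 10) (.reg 16))
      (.seq (.setNat 16 (.const 0)) (.setNat 15 (.add (.reg 15) (.const 1)))) .skip

theorem mul_add_inj {d x y r r' : ℕ} (hr : r < d) (hr' : r' < d) (h : x * d + r = y * d + r') :
    x = y ∧ r = r' := by
  have h1 : (x * d + r) / d = x := by
    rw [add_comm, Nat.add_mul_div_right _ _ (by omega), Nat.div_eq_of_lt hr, zero_add]
  have h2 : (y * d + r') / d = y := by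
    rw [add_comm, Nat.add_mul_div_right _ _ (by omega), Nat.div_eq_of_lt hr', zero_add]
  have : x = y := by rw [← h1, h, h2]
  subst this
  exact ⟨rfl, by omega⟩

theorem mul_add_lt_mul_self {d x r : ℕ} (hx : x < d) (hr : r < d) : x * d + r < d * d := by
  have := Nat.mul_le_mul_right d (Nat.succ_le_of_lt hx)
  rw [Nat.succ_mul] at this
  omega

theorem fillFactors_spec {n L d : ℕ} {P : ℕ → ℝ} {σ : State} (h : HoldsSums n L P σ)
    (hd : 1 ≤ d) (h10 : σ.nat 10 = d) (h11 : σ.nat 11 = d * d) :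
    Wp fillFactors (fun t σ' => t ≤ 100 * (d * d) + 20 ∧
      (∀ x < d, ∀ y < d, σ'.realArr 100 (x * d + y) = padLeft n P (σ.nat 12 + (x * d + y))) ∧
      ∀ y < d, ∀ r < d, σ'.realArr 101 (y * d + r) =
        padRight n P (σ.real 5) (σ.nat 12 + σ.nat 13 + r + y)) σ := by
  simp only [fillFactors, wp_seq, wp_setNat]
  refine (wp_while (fun σ' => σ'.nat 14 = σ'.nat 15 * d + σ'.nat 16 ∧ σ'.nat 16 < d ∧
    σ'.nat 14 ≤ d * d ∧
    (∀ k < σ'.nat 14, σ'.realArr 100 k = padLeft n P (σ.nat 12 + k)) ∧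
    ∀ y r, r < d → y * d + r < σ'.nat 14 → σ'.realArr 101 (y * d + r) =
        padRight n P (σ.real 5) (σ.nat 12 + σ.nat 13 + r + y))
    (fun σ => 90 * (d * d - σ.nat 14)) ?_ ?_).mono ?_
  · simp; omega
  · intro σ₁ hF ⟨hidx, hr, hle, hA, hB⟩ hlt
    have e0 : σ₁.nat 0 = n := (hF.nat 0 rfl).trans (by simpa using h.size)
    have e10 : σ₁.nat 10 = d := (hF.nat 10 rfl).trans (by simpa using h10)
    have e11 : σ₁.nat 11 = d * d := (hF.nat 11 rfl).trans (by simpa using h11)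
    have e12 : σ₁.nat 12 = σ.nat 12 := (hF.nat 12 rfl).trans (by simp)
    have e13 : σ₁.nat 13 = σ.nat 13 := (hF.nat 13 rfl).trans (by simp)
    have e5 : σ₁.real 5 = σ.real 5 := (hF.real 5 rfl).trans (by simp)
    have eP : ∀ k ≤ n, σ₁.realArr 2 k = P k := fun k hk => by
      rw [hF.realArr 2 rfl]; simpa using h.sums k hk
    simp [e11] at hlt
    -- The new entry of the second factor, whichever way it has been computed.
    have hB' : ∀ v : ℝ, v = padRight n P (σ.real 5) (σ.nat 12 + σ.nat 13 + σ₁.nat 16 + σ₁.nat 15) →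
        ∀ y r, r < d → y * d + r ≤ σ₁.nat 14 →
        (if y * d + r = σ₁.nat 14 then v else σ₁.realArr 101 (y * d + r)) =
          padRight n P (σ.real 5) (σ.nat 12 + σ.nat 13 + r + y) := by
      intro v hv y r hrd hyr
      split_ifs with he
      · obtain ⟨rfl, rfl⟩ := mul_add_inj hrd hr (he.trans hidx)
        exact hv
      · exact hB y r hrd (by omega)
    have hA' : ∀ v : ℝ, v = padLeft n P (σ.nat 12 + σ₁.nat 14) →
        ∀ k ≤ σ₁.nat 14, (if k = σ₁.nat 14 then v else σ₁.realArr 100 k) =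
          padLeft n P (σ.nat 12 + k) := by
      intro v hv k hk
      split_ifs with he
      · rw [he, hv]
      · exact hA k (by omega)
    have hrow : d ≤ σ₁.nat 16 + 1 → σ₁.nat 14 + 1 = (σ₁.nat 15 + 1) * d := fun h => by
      rw [Nat.succ_mul]; omega
    simp [e0, e10, e12, e13, e5]
    refine ⟨fun h1 => ⟨fun h2 => ⟨fun h3 => ?_, fun h3 => ?_⟩,
      fun h2 => ⟨fun h3 => ?_, fun h3 => ?_⟩⟩,
      fun h1 => ⟨fun h2 => ⟨fun h3 => ?_, fun h3 => ?_⟩,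
        fun h2 => ⟨fun h3 => ?_, fun h3 => ?_⟩⟩⟩
    · exact ⟨⟨hrow h3, hd, hlt, hA' _ (by rw [padLeft, if_pos h1, eP _ h1]),
        hB' _ (by rw [padRight, if_pos h2, eP _ h2])⟩, by omega⟩
    · exact ⟨⟨by omega, h3, hlt, hA' _ (by rw [padLeft, if_pos h1, eP _ h1]),
        hB' _ (by rw [padRight, if_pos h2, eP _ h2])⟩, by omega⟩
    · exact ⟨⟨hrow h3, hd, hlt, hA' _ (by rw [padLeft, if_pos h1, eP _ h1]),
        hB' _ (by rw [padRight, if_neg (by omega)])⟩, by omega⟩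
    · exact ⟨⟨by omega, h3, hlt, hA' _ (by rw [padLeft, if_pos h1, eP _ h1]),
        hB' _ (by rw [padRight, if_neg (by omega)])⟩, by omega⟩
    · exact ⟨⟨hrow h3, hd, hlt, hA' _ (by rw [padLeft, if_neg (by omega)]),
        hB' _ (by rw [padRight, if_pos h2, eP _ h2])⟩, by omega⟩
    · exact ⟨⟨by omega, h3, hlt, hA' _ (by rw [padLeft, if_neg (by omega)]),
        hB' _ (by rw [padRight, if_pos h2, eP _ h2])⟩, by omega⟩
    · exact ⟨⟨hrow h3, hd, hlt, hA' _ (by rw [padLeft, if_neg (by omega)]),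
        hB' _ (by rw [padRight, if_neg (by omega)])⟩, by omega⟩
    · exact ⟨⟨by omega, h3, hlt, hA' _ (by rw [padLeft, if_neg (by omega)]),
        hB' _ (by rw [padRight, if_neg (by omega)])⟩, by omega⟩
  · rintro t σ₁ ⟨hF, ⟨hidx, hr, hle, hA, hB⟩, hlt, ht⟩
    have e11 : σ₁.nat 11 = d * d := (hF.nat 11 rfl).trans (by simpa using h11)
    simp [e11] at hlt ht ⊢
    have e : σ₁.nat 14 = d * d := le_antisymm hle hlt
    rw [e] at hA hB
    exact ⟨by omega, fun x hx y hy => hA _ (mul_add_lt_mul_self hx hy),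
      fun y hy r hr => hB y r hr (mul_add_lt_mul_self hy hr)⟩

/-- The register `18` holds a length between `L` and `2L - 1`, and the real register `3` the
eccentricity of an interval of this length. -/
structure HoldsLength (n L : ℕ) (P : ℕ → ℝ) (σ : State) : Prop where
  le : L ≤ σ.nat 18
  lt : σ.nat 18 < 2 * L
  value : ∃ i, i + σ.nat 18 ≤ n ∧ σ.real 3 = diffEcc P i (i + σ.nat 18)

/-- The entry in row `x` and column `r` of the product belongs to some interval of length between
`L` and `2L - 1`. -/
def IsUseful (n L d s g x r : ℕ) : Prop :=
  L + x * d ≤ g + r ∧ g + r < x * d + (L + L) ∧ s + g + r ≤ n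

/-- Compares an entry of a min-plus product with the eccentricity of the best interval found so
far. The entry in row `x` and column `r` belongs to intervals of length `g + r - x d`; the registers
`16` and `17` hold `r` and `x d`. -/
def tryEntry : Prog :=
  .ite (.and (.natLe (.add (.reg 1) (.reg 17)) (.add (.reg 13) (.reg 16)))
      (.and (.natLe (.add (.add (.reg 13) (.reg 16)) (.const 1))
        (.add (.reg 17) (.add (.reg 1) (.reg 1))))
      (.natLe (.add (.add (.reg 12) (.reg 13)) (.reg 16)) (.reg 0))))
    (.seq (.setNat 19 (.sub (.add (.reg 13) (.reg 16)) (.reg 17))) <|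
      .seq (.setReal 4 (.div (.sub (.ofNat (.const 0)) (.get 102 (.reg 14)))
        (.sqrt (.ofNat (.reg 19))))) <|
      .ite (.realLe (.reg 3) (.reg 4))
        (.seq (.setReal 3 (.reg 4)) (.setNat 18 (.reg 19))) .skip) .skip

theorem tryEntry_spec {n L d s g x : ℕ} {P : ℕ → ℝ} {σ : State} (h : HoldsSums n L P σ)
    (h12 : σ.nat 12 = s) (h13 : σ.nat 13 = g) (h17 : σ.nat 17 = x * d)
    (hl : HoldsLength n L P σ)
    (hC : IsUseful n L d s g x (σ.nat 16) → ∃ i, i + (g + σ.nat 16 - x * d) ≤ n ∧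
      -σ.realArr 102 (σ.nat 14) = P (i + (g + σ.nat 16 - x * d)) - P i) :
    Wp tryEntry (fun t σ' => t ≤ 70 ∧ HoldsLength n L P σ' ∧ σ.real 3 ≤ σ'.real 3 ∧
      (IsUseful n L d s g x (σ.nat 16) →
        -σ.realArr 102 (σ.nat 14) / Real.sqrt ((g + σ.nat 16 - x * d : ℕ) : ℝ) ≤ σ'.real 3)) σ := by
  rw [tryEntry, wp_ite]
  constructor
  · intro hu
    have hu' : IsUseful n L d s g x (σ.nat 16) := by
      simpa [IsUseful, h.size, h.bound, h12, h13, h17, Nat.succ_le_iff] using hu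
    obtain ⟨i, hin, hi⟩ := hC hu'
    have hlen : L ≤ g + σ.nat 16 - x * d ∧ g + σ.nat 16 - x * d < 2 * L := by
      obtain ⟨h1, h2, -⟩ := hu'
      omega
    simp [h13, h17, hu']
    refine ⟨fun hle => ⟨⟨by simpa using hlen.1, by simpa using hlen.2, i, by simpa using hin, ?_⟩,
      hle⟩, fun hlt => ⟨⟨by simpa using hl.le, by simpa using hl.lt, by simpa using hl.value⟩,
        hlt.le⟩⟩
    simp [diffEcc, ← hi]
  · intro hu
    have hu' : ¬ IsUseful n L d s g x (σ.nat 16) := by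
      simpa [IsUseful, h.size, h.bound, h12, h13, h17, Nat.succ_le_iff] using hu
    simp [hu', hl]

/-- Compares all entries of a min-plus product with the eccentricity of the best interval found so
far. -/
def readProduct : Prog :=
  .seq (.setNat 14 (.const 0)) <|
  .seq (.setNat 17 (.const 0)) <|
  .seq (.setNat 16 (.const 0)) <|
  .while (.natLe (.add (.reg 14) (.const 1)) (.reg 11)) <|
    .seq tryEntry <|
    .seq (.setNat 14 (.add (.reg 14) (.const 1))) <|
    .seq (.setNat 16 (.add (.reg 16) (.const 1))) <|
    .ite (.natLe (.reg 10) (.reg 16))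
      (.seq (.setNat 16 (.const 0)) (.setNat 17 (.add (.reg 17) (.reg 10)))) .skip

theorem readProduct_spec {n L d s g : ℕ} {P : ℕ → ℝ} {σ : State} (h : HoldsSums n L P σ)
    (hd : 1 ≤ d) (h10 : σ.nat 10 = d) (h11 : σ.nat 11 = d * d) (h12 : σ.nat 12 = s)
    (h13 : σ.nat 13 = g) (hl : HoldsLength n L P σ)
    (hC : ∀ x < d, ∀ r < d, IsUseful n L d s g x r → ∃ i, i + (g + r - x * d) ≤ n ∧
      -σ.realArr 102 (x * d + r) = P (i + (g + r - x * d)) - P i) :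
    Wp readProduct (fun t σ' => t ≤ 150 * (d * d) + 20 ∧ HoldsLength n L P σ' ∧
      σ.real 3 ≤ σ'.real 3 ∧
      ∀ x < d, ∀ r < d, IsUseful n L d s g x r →
        -σ.realArr 102 (x * d + r) / Real.sqrt ((g + r - x * d : ℕ) : ℝ) ≤ σ'.real 3) σ := by
  simp only [readProduct, wp_seq, wp_setNat]
  refine (wp_while (fun σ' => (∃ x, σ'.nat 17 = x * d) ∧ σ'.nat 14 = σ'.nat 17 + σ'.nat 16 ∧
    σ'.nat 16 < d ∧ σ'.nat 14 ≤ d * d ∧ HoldsLength n L P σ' ∧ σ.real 3 ≤ σ'.real 3 ∧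
    ∀ x r, r < d → x * d + r < σ'.nat 14 → IsUseful n L d s g x r →
        -σ.realArr 102 (x * d + r) / Real.sqrt ((g + r - x * d : ℕ) : ℝ) ≤ σ'.real 3)
    (fun σ => 120 * (d * d - σ.nat 14)) ?_ ?_).mono ?_
  · refine ⟨⟨0, by simp⟩, by simp, by simp; omega, by simp,
      ⟨by simpa using hl.le, by simpa using hl.lt, by simpa using hl.value⟩, by simp, by simp⟩
  · intro σ₁ hF ⟨⟨x, hx⟩, hidx, hr, hle, hl₁, hmono, hall⟩ hlt
    have e0 : σ₁.nat 0 = n := (hF.nat 0 rfl).trans (by simpa using h.size)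
    have e1 : σ₁.nat 1 = L := (hF.nat 1 rfl).trans (by simpa using h.bound)
    have e10 : σ₁.nat 10 = d := (hF.nat 10 rfl).trans (by simpa using h10)
    have e11 : σ₁.nat 11 = d * d := (hF.nat 11 rfl).trans (by simpa using h11)
    have e12 : σ₁.nat 12 = s := (hF.nat 12 rfl).trans (by simpa using h12)
    have e13 : σ₁.nat 13 = g := (hF.nat 13 rfl).trans (by simpa using h13)
    have eC : σ₁.realArr 102 = σ.realArr 102 := (hF.realArr 102 rfl).trans (by simp)
    simp [e11] at hlt
    have hxd : x < d := by
      by_contra! hcon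
      have := Nat.mul_le_mul_right d hcon
      omega
    have hrow : ∃ y, x * d + d = y * d := ⟨x + 1, by ring⟩
    rw [wp_seq]
    refine (tryEntry_spec ⟨e0, e1, fun k hk => ?_⟩ e12 e13 hx hl₁ fun hu => ?_).frame.mono ?_
    · rw [hF.realArr 2 rfl]
      simpa using h.sums k hk
    · rw [eC, hidx, hx]
      exact hC x hxd _ hr hu
    rintro t σ₂ ⟨hF₂, ht, hl₂, hmono₂, hnew⟩
    have f10 : σ₂.nat 10 = d := (hF₂.nat 10 rfl).trans e10
    have f17 : σ₂.nat 17 = x * d := (hF₂.nat 17 rfl).trans hx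
    have f16 : σ₂.nat 16 = σ₁.nat 16 := hF₂.nat 16 rfl
    have f14 : σ₂.nat 14 = σ₁.nat 14 := hF₂.nat 14 rfl
    have hall₂ : ∀ x' r', r' < d → x' * d + r' ≤ σ₁.nat 14 → IsUseful n L d s g x' r' →
        -σ.realArr 102 (x' * d + r') / Real.sqrt ((g + r' - x' * d : ℕ) : ℝ) ≤ σ₂.real 3 := by
      intro x' r' hr' hle' hu
      rcases hle'.eq_or_lt with he | hlt'
      · rw [hidx, hx] at he
        obtain ⟨rfl, rfl⟩ := mul_add_inj hr' hr he
        rw [hidx, hx, eC] at hnew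
        exact hnew hu
      · exact (hall x' r' hr' hlt' hu).trans hmono₂
    simp [f10, f17, f16, f14]
    refine ⟨fun h3 => ⟨⟨hrow, by omega, hd, hlt, ?_, hmono.trans hmono₂, hall₂⟩, by omega⟩,
      fun h3 => ⟨⟨by omega, h3, hlt, ?_, hmono.trans hmono₂, hall₂⟩, by omega⟩⟩
    · exact ⟨by simpa using hl₂.le, by simpa using hl₂.lt, by simpa using hl₂.value⟩
    · exact ⟨by simpa using hl₂.le, by simpa using hl₂.lt, by simpa using hl₂.value⟩
  · rintro t σ₁ ⟨hF, ⟨hx, hidx, hr, hle, hl₁, hmono, hall⟩, hlt, ht⟩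
    have e11 : σ₁.nat 11 = d * d := (hF.nat 11 rfl).trans (by simpa using h11)
    simp [e11] at hlt ht ⊢
    have e : σ₁.nat 14 = d * d := le_antisymm hle hlt
    rw [e] at hall
    exact ⟨by omega, hl₁, hmono, fun x hx r hr => hall x r hr (mul_add_lt_mul_self hx hr)⟩

end PSEI

namespace PSEI

open RealRAM

/-- With a program `M` for min-plus products: tries all intervals that start in the block of `d ^ 2`
positions from `s` on, and whose start and end have positions differing by about `g`. -/
def processBlock (M : Prog) : Prog :=
  .seq fillFactors <| .seq (.setNat 100 (.reg 10)) <| .seq M.shift readProduct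

section Writes

variable (M : Prog)

theorem processBlock_writesNat {x : ℕ} (hx : x < 14) :
    (processBlock M).writesNat x = false := by
  simp [processBlock, Prog.writesNat, fillFactors, readProduct, tryEntry,
    M.writesNat_shift (by omega : x < 100)]
  omega

theorem processBlock_writesReal : (processBlock M).writesReal 5 = false := by
  simp [processBlock, Prog.writesReal, fillFactors, readProduct, tryEntry, M.writesReal_shift]

theorem processBlock_writesRealArr : (processBlock M).writesRealArr 2 = false := by
  simp [processBlock, Prog.writesRealArr, fillFactors, readProduct, tryEntry,
    M.writesRealArr_shift]

end Writes

/-- The memory during the computation of min-plus products: the register `10` holds `d` and the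
register `11` its square, the real register `5` holds a number that is larger than all differences
of prefix sums. -/
structure HoldsSetup (n L d : ℕ) (P : ℕ → ℝ) (B : ℝ) (σ : State) : Prop
    extends HoldsSums n L P σ where
  dim : σ.nat 10 = d
  sq : σ.nat 11 = d * d
  large : σ.real 5 = 3 * B + 1

theorem HoldsSetup.frame {n L d : ℕ} {P : ℕ → ℝ} {B : ℝ} {p : Prog} {σ σ' : State}
    (h : HoldsSetup n L d P B σ) (hF : Frame p σ σ') (h₀ : p.writesNat 0 = false)
    (h₁ : p.writesNat 1 = false) (h₂ : p.writesRealArr 2 = false) (h₃ : p.writesNat 10 = false)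
    (h₄ : p.writesNat 11 = false) (h₅ : p.writesReal 5 = false) : HoldsSetup n L d P B σ' :=
  ⟨h.toHoldsSums.frame hF h₀ h₁ h₂, (hF.nat 10 h₃).trans h.dim, (hF.nat 11 h₄).trans h.sq,
    (hF.real 5 h₅).trans h.large⟩

/-- `v` is at least the eccentricity of all intervals `[s + x d + y + 1, e] ⊆ [1, n]` of length
between `L` and `2L - 1` with `x, y < d` and `e = s + g + r + y` for some `r < d`. -/
def Covers (n L d : ℕ) (P : ℕ → ℝ) (s g : ℕ) (v : ℝ) : Prop :=
  ∀ x < d, ∀ r < d, IsUseful n L d s g x r → ∀ y < d, s + g + r + y ≤ n →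
    diffEcc P (s + x * d + y) (s + g + r + y) ≤ v

theorem Covers.mono {n L d s g : ℕ} {P : ℕ → ℝ} {v w : ℝ} (h : Covers n L d P s g v)
    (hvw : v ≤ w) : Covers n L d P s g w :=
  fun x hx r hr hu y hy hn => (h x hx r hr hu y hy hn).trans hvw

theorem processBlock_spec {n L d s g : ℕ} {P : ℕ → ℝ} {B : ℝ} {T : ℕ → ℝ} {M : Prog}
    (hM : ComputesMinPlusProduct M T) (hd : 1 ≤ d) (hB : ∀ k ≤ n, |P k| ≤ B) {σ : State}
    (h : HoldsSetup n L d P B σ) (h12 : σ.nat 12 = s) (h13 : σ.nat 13 = g)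
    (hl : HoldsLength n L P σ) :
    Wp (processBlock M) (fun t σ' => t ≤ ⌊T d⌋₊ + 250 * (d * d) + 50 ∧ HoldsLength n L P σ' ∧
      σ.real 3 ≤ σ'.real 3 ∧ Covers n L d P s g (σ'.real 3)) σ := by
  simp only [processBlock, wp_seq, wp_setNat]
  refine (fillFactors_spec h.toHoldsSums hd h.dim h.sq).frame.mono ?_
  rintro t₁ σ₁ ⟨hF₁, ht₁, hA₁, hB₁⟩
  have hH₁ := h.frame hF₁ rfl rfl rfl rfl rfl rfl
  rw [h12] at hA₁ hB₁
  rw [h13, h.large] at hB₁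
  refine (hM.wp_shift hd (σ := σ₁.setNat 100 (NExpr.eval σ₁ (.reg 10)))
    (by simp [hH₁.dim])).frame.mono ?_
  rintro t₂ σ₂ ⟨hF₂, ht₂, hC⟩
  have e3 : σ₂.real 3 = σ.real 3 :=
    (hF₂.real 3 (M.writesReal_shift (by omega))).trans (hF₁.real 3 rfl)
  have eN : ∀ x < 14, σ₂.nat x = σ₁.nat x := fun x hx => by
    rw [hF₂.nat x (M.writesNat_shift (by omega))]
    have : x ≠ 100 := by omega
    simp [this]
  have e18 : σ₂.nat 18 = σ.nat 18 := by
    rw [hF₂.nat 18 (M.writesNat_shift (by omega))]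
    simpa using hF₁.nat 18 rfl
  have eP : σ₂.realArr 2 = σ₁.realArr 2 := hF₂.realArr 2 (M.writesRealArr_shift (by omega))
  have hH₂ : HoldsSums n L P σ₂ := ⟨(eN 0 (by omega)).trans hH₁.size,
    (eN 1 (by omega)).trans hH₁.bound, by rw [eP]; exact hH₁.sums⟩
  have hB0 : 0 ≤ B := (abs_nonneg _).trans (hB 0 (Nat.zero_le _))
  have hpad : ∀ k, -B ≤ padLeft n P k := fun k => by
    rw [padLeft]
    split_ifs with hk
    · exact (abs_le.1 (hB k hk)).1
    · linarith
  -- The entries of the product, in terms of the prefix sums.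
  have hle : ∀ x < d, ∀ r < d, IsUseful n L d s g x r → ∀ y < d, s + g + r + y ≤ n →
      σ₂.realArr 102 (x * d + r) ≤ P (s + x * d + y) - P (s + g + r + y) := by
    intro x hx r hr hu y hy hn
    have h1 := (hC x hx r hr).1 y hy
    have hle : s + (x * d + y) ≤ n := by have := hu.1; omega
    simp only [State.realArr_setNat] at h1
    rw [hA₁ x hx y hy, hB₁ y hy r hr, padLeft, padRight, if_pos hn, if_pos hle,
      ← add_assoc s] at h1
    linarith
  have hex : ∀ x < d, ∀ r < d, IsUseful n L d s g x r → ∃ i, i + (g + r - x * d) ≤ n ∧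
      -σ₂.realArr 102 (x * d + r) = P (i + (g + r - x * d)) - P i := by
    intro x hx r hr hu
    obtain ⟨y, hy, h1⟩ := (hC x hx r hr).2
    simp only [State.realArr_setNat] at h1
    rw [hA₁ x hx y hy, hB₁ y hy r hr] at h1
    have hu1 := hu.1
    by_cases hn : s + g + r + y ≤ n
    · refine ⟨s + x * d + y, by omega, ?_⟩
      rw [padLeft, padRight, if_pos hn, if_pos (by omega), ← add_assoc s] at h1
      rw [show s + x * d + y + (g + r - x * d) = s + g + r + y by omega]
      linarith
    · -- The padding is so large that the minimum is not attained in it.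
      exfalso
      rw [padRight, if_neg hn] at h1
      have h2 := hle x hx r hr hu 0 (by omega) hu.2.2
      have h3 := hpad (s + (x * d + y))
      have h4 := (abs_le.1 (hB (s + x * d + 0) (by have := hu.2.2; omega))).2
      have h5 := (abs_le.1 (hB (s + g + r + 0) hu.2.2)).1
      linarith
  refine (readProduct_spec (s := s) (g := g) hH₂ hd ((eN 10 (by omega)).trans hH₁.dim)
    ((eN 11 (by omega)).trans hH₁.sq) ?_ ?_ ?_ hex).mono ?_
  · rw [eN 12 (by omega), ← h12]
    exact hF₁.nat 12 rfl
  · rw [eN 13 (by omega), ← h13]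
    exact hF₁.nat 13 rfl
  · exact ⟨by rw [e18]; exact hl.le, by rw [e18]; exact hl.lt, by rw [e18, e3]; exact hl.value⟩
  rintro t₃ σ₃ ⟨ht₃, hl₃, hmono, hval⟩
  refine ⟨by simp only [NExpr.cost]; omega, hl₃, e3 ▸ hmono, fun x hx r hr hu y hy hn => ?_⟩
  refine le_trans ?_ (hval x hx r hr hu)
  rw [diffEcc, show s + g + r + y - (s + x * d + y) = g + r - x * d by omega]
  gcongr
  linarith [hle x hx r hr hu y hy hn]

/-- Tries all intervals of length between `L` and `2L - 1` that start in the block of `d ^ 2`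
positions from `s` on. The register `13` runs through the multiples `g` of `d`. -/
def processOffsets (M : Prog) : Prog :=
  .seq (.setNat 13 (.const 0)) <|
  .while (.natLe (.add (.reg 13) (.const 1)) (.add (.reg 11) (.add (.reg 1) (.reg 1)))) <|
    .seq (processBlock M) (.setNat 13 (.add (.reg 13) (.reg 10)))

/-- At most `(d ^ 2 + 2L + d) / d` min-plus products are computed for a block: this many multiples
of `d` may be below `d ^ 2 + 2L`. -/
theorem processOffsets_spec {n L d s : ℕ} {P : ℕ → ℝ} {B : ℝ} {T : ℕ → ℝ} {M : Prog}
    (hM : ComputesMinPlusProduct M T) (hd : 1 ≤ d) (hB : ∀ k ≤ n, |P k| ≤ B) {σ : State}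
    (h : HoldsSetup n L d P B σ) (h12 : σ.nat 12 = s) (hl : HoldsLength n L P σ) :
    Wp (processOffsets M) (fun t σ' =>
      t ≤ (d * d + 2 * L + d) / d * (⌊T d⌋₊ + 250 * (d * d) + 70) + 20 ∧
      HoldsSetup n L d P B σ' ∧ σ'.nat 12 = s ∧ HoldsLength n L P σ' ∧ σ.real 3 ≤ σ'.real 3 ∧
      ∀ a, a * d < d * d + 2 * L → Covers n L d P s (a * d) (σ'.real 3)) σ := by
  simp only [processOffsets, wp_seq, wp_setNat]
  set σ₀ := σ.setNat 13 (NExpr.eval σ (.const 0)) with hσ₀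
  have hH₀ : HoldsSetup n L d P B σ₀ := ⟨⟨by simp [hσ₀, h.size], by simp [hσ₀, h.bound],
    by simpa [hσ₀] using h.sums⟩, by simp [hσ₀, h.dim], by simp [hσ₀, h.sq],
    by simp [hσ₀, h.large]⟩
  have h12₀ : σ₀.nat 12 = s := by simp [hσ₀, h12]
  have h13₀ : σ₀.nat 13 = 0 := by simp [hσ₀]
  have h3₀ : σ₀.real 3 = σ.real 3 := by simp [hσ₀]
  have hl₀ : HoldsLength n L P σ₀ := ⟨by simpa [hσ₀] using hl.le, by simpa [hσ₀] using hl.lt,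
    by simpa [hσ₀] using hl.value⟩
  clear_value σ₀
  have hw : ∀ x < 13, ((processBlock M).seq (.setNat 13 (.add (.reg 13) (.reg 10)))).writesNat x =
      false := fun x hx => by
    simp [Prog.writesNat, processBlock_writesNat M (by omega : x < 14)]; omega
  have hw' : ((processBlock M).seq (.setNat 13 (.add (.reg 13) (.reg 10)))).writesReal 5 =
      false := by simp [Prog.writesReal, processBlock_writesReal M]
  have hw'' : ((processBlock M).seq (.setNat 13 (.add (.reg 13) (.reg 10)))).writesRealArr 2 =
      false := by simp [Prog.writesRealArr, processBlock_writesRealArr M]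
  refine (wp_while (fun σ' => HoldsLength n L P σ' ∧ σ.real 3 ≤ σ'.real 3 ∧
    (∃ a, σ'.nat 13 = a * d) ∧ ∀ a, a * d < σ'.nat 13 → Covers n L d P s (a * d) (σ'.real 3))
    (fun σ' => (d * d + 2 * L + d - σ'.nat 13) / d * (⌊T d⌋₊ + 250 * (d * d) + 70)) ?_ ?_).mono ?_
  · exact ⟨hl₀, h3₀.ge, ⟨0, by simp [h13₀]⟩, fun a ha => absurd ha (by omega)⟩
  · intro σ₁ hF ⟨hl₁, hmono, ⟨a, ha⟩, hcov⟩ hlt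
    have hH₁ := hH₀.frame hF (hw 0 (by omega)) (hw 1 (by omega)) hw'' (hw 10 (by omega))
      (hw 11 (by omega)) hw'
    have e12 : σ₁.nat 12 = s := (hF.nat 12 (hw 12 (by omega))).trans h12₀
    simp [hH₁.sq, hH₁.bound] at hlt
    simp only [wp_seq]
    refine (processBlock_spec hM hd hB hH₁ e12 ha hl₁).frame.mono ?_
    rintro t₂ σ₂ ⟨hF₂, ht₂, hl₂, hmono₂, hcov₂⟩
    have e13 : σ₂.nat 13 = a * d :=
      (hF₂.nat 13 (processBlock_writesNat M (by omega))).trans ha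
    have e10 : σ₂.nat 10 = d :=
      (hF₂.nat 10 (processBlock_writesNat M (by omega))).trans hH₁.dim
    have hdiv : (d * d + 2 * L + d - a * d) / d = (d * d + 2 * L + d - (a * d + d)) / d + 1 := by
      rw [Nat.div_eq_sub_div hd (by omega), Nat.sub_sub]
    simp [e13, e10, ha, hdiv]
    refine ⟨⟨⟨by simpa using hl₂.le, by simpa using hl₂.lt, by simpa using hl₂.value⟩,
      hmono.trans hmono₂, ⟨a + 1, by ring⟩, fun a' ha' => ?_⟩, ?_⟩
    · rcases lt_or_ge (a' * d) (a * d) with h' | h'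
      · exact (hcov a' (ha ▸ h')).mono hmono₂
      · have : a' < a + 1 := by
          rw [← Nat.succ_mul] at ha'
          exact Nat.lt_of_mul_lt_mul_right ha'
        have : a ≤ a' := Nat.le_of_mul_le_mul_right h' hd
        obtain rfl : a' = a := by omega
        exact hcov₂
    · rw [Nat.succ_mul (_ / d)]
      omega
  · rintro t σ₁ ⟨hF, ⟨hl₁, hmono, ha, hcov⟩, hlt, ht⟩
    have hH₁ := hH₀.frame hF (hw 0 (by omega)) (hw 1 (by omega)) hw'' (hw 10 (by omega))
      (hw 11 (by omega)) hw'
    have e12 : σ₁.nat 12 = s := (hF.nat 12 (hw 12 (by omega))).trans h12₀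
    simp [hH₁.sq, hH₁.bound] at hlt
    simp [h13₀] at ht ⊢
    exact ⟨by omega, hH₁, e12, hl₁, hmono, fun a ha => hcov a (by omega)⟩

/-- Tries all intervals of length between `L` and `2L - 1`. The register `12` runs through the
multiples `s` of `d ^ 2`. -/
def processBlocks (M : Prog) : Prog :=
  .seq (.setNat 12 (.const 0)) <|
  .while (.natLe (.reg 12) (.reg 0)) <|
    .seq (processOffsets M) (.setNat 12 (.add (.reg 12) (.reg 11)))

theorem processBlocks_spec {n L d : ℕ} {P : ℕ → ℝ} {B : ℝ} {T : ℕ → ℝ} {M : Prog}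
    (hM : ComputesMinPlusProduct M T) (hd : 1 ≤ d) (hB : ∀ k ≤ n, |P k| ≤ B) {σ : State}
    (h : HoldsSetup n L d P B σ) (hl : HoldsLength n L P σ) :
    Wp (processBlocks M) (fun t σ' =>
      t ≤ (n + d * d) / (d * d) *
        ((d * d + 2 * L + d) / d * (⌊T d⌋₊ + 250 * (d * d) + 70) + 40) + 20 ∧
      HoldsSums n L P σ' ∧ HoldsLength n L P σ' ∧
      ∀ i l, L ≤ l → l < 2 * L → i + l ≤ n → diffEcc P i (i + l) ≤ σ'.real 3) σ := by
  simp only [processBlocks, wp_seq, wp_setNat]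
  refine (wp_while (fun σ' => HoldsSetup n L d P B σ' ∧ HoldsLength n L P σ' ∧
    (∃ a, σ'.nat 12 = a * (d * d)) ∧
    ∀ b, b * (d * d) < σ'.nat 12 → ∀ a, a * d < d * d + 2 * L →
      Covers n L d P (b * (d * d)) (a * d) (σ'.real 3))
    (fun σ' => (n + d * d - σ'.nat 12) / (d * d) *
      ((d * d + 2 * L + d) / d * (⌊T d⌋₊ + 250 * (d * d) + 70) + 40)) ?_ ?_).mono ?_
  · exact ⟨⟨⟨by simp [h.size], by simp [h.bound], by simpa using h.sums⟩, by simp [h.dim],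
      by simp [h.sq], by simp [h.large]⟩, ⟨by simpa using hl.le, by simpa using hl.lt,
      by simpa using hl.value⟩, ⟨0, by simp⟩, fun b hb => absurd hb (by simp)⟩
  · intro σ₁ _ ⟨hH₁, hl₁, ⟨b, hb⟩, hcov⟩ hlt
    have hdd : 1 ≤ d * d := Nat.mul_pos hd hd
    simp [hH₁.size] at hlt
    simp only [wp_seq]
    refine (processOffsets_spec hM hd hB hH₁ hb hl₁).mono ?_
    rintro t₂ σ₂ ⟨ht₂, hH₂, e12, hl₂, hmono₂, hcov₂⟩
    have hdiv : (n + d * d - b * (d * d)) / (d * d) =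
        (n + d * d - (b * (d * d) + d * d)) / (d * d) + 1 := by
      rw [Nat.div_eq_sub_div hdd (by omega), Nat.sub_sub]
    simp [e12, hH₂.sq, hb, hdiv]
    refine ⟨⟨⟨⟨by simp [hH₂.size], by simp [hH₂.bound], by simpa using hH₂.sums⟩,
      by simp [hH₂.dim], by simp [hH₂.sq], by simp [hH₂.large]⟩, ⟨by simpa using hl₂.le,
      by simpa using hl₂.lt, by simpa using hl₂.value⟩, ⟨b + 1, by ring⟩, fun b' hb' a ha => ?_⟩, ?_⟩
    · rcases lt_or_ge (b' * (d * d)) (b * (d * d)) with h' | h'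
      · exact (hcov b' (hb ▸ h') a ha).mono hmono₂
      · have : b' < b + 1 := by
          rw [← Nat.succ_mul] at hb'
          exact Nat.lt_of_mul_lt_mul_right hb'
        have : b ≤ b' := Nat.le_of_mul_le_mul_right h' hdd
        obtain rfl : b' = b := by omega
        exact hcov₂ a ha
    · rw [Nat.succ_mul (_ / (d * d))]
      omega
  · rintro t σ₁ ⟨_, ⟨hH₁, hl₁, _, hcov⟩, hlt, ht⟩
    simp [hH₁.size] at hlt
    simp at ht ⊢
    refine ⟨by omega, hH₁.toHoldsSums, hl₁, fun i l hL hl hn => ?_⟩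
    have hdd : 0 < d * d := Nat.mul_pos hd hd
    -- The start is written as `s + x d + y`, and `l + x d` as `g + r`.
    have h1 := Nat.div_add_mod' i (d * d)
    have h2 := Nat.div_add_mod' (i % (d * d)) d
    set x := i % (d * d) / d
    set y := i % (d * d) % d
    have h3 := Nat.div_add_mod' (l + x * d) d
    set a := (l + x * d) / d
    set r := (l + x * d) % d
    have hx : x < d := Nat.div_lt_of_lt_mul (Nat.mod_lt _ hdd)
    have hy : y < d := Nat.mod_lt _ hd
    have hr : r < d := Nat.mod_lt _ hd
    have hxd : x * d + d ≤ d * d := by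
      rw [← Nat.succ_mul]
      exact Nat.mul_le_mul_right d hx
    have := hcov (i / (d * d)) (by omega) a (by omega) x hx r hr ⟨by omega, by omega, by omega⟩
      y hy (by omega)
    convert this using 2 <;> omega

/-- Computes, in the integer registers `4` and `5`, an interval of largest eccentricity among those
of the length in the register `18`. -/
def bestStart : Prog :=
  .seq (.setNat 4 (.const 0)) <|
  .seq (.setNat 6 (.const 0)) <|
  .seq (.while (.natLe (.add (.reg 6) (.reg 18)) (.reg 0)) <|
    .seq (.ite (.realLe (.sub (.get 2 (.add (.reg 4) (.reg 18))) (.get 2 (.reg 4)))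
      (.sub (.get 2 (.add (.reg 6) (.reg 18))) (.get 2 (.reg 6)))) (.setNat 4 (.reg 6)) .skip) <|
    .setNat 6 (.add (.reg 6) (.const 1))) <|
  .setNat 5 (.add (.reg 4) (.reg 18))

theorem bestStart_spec {n L l : ℕ} {P : ℕ → ℝ} {σ : State} (h : HoldsSums n L P σ)
    (h18 : σ.nat 18 = l) (hl : l ≤ n) :
    Wp bestStart (fun t σ' => t ≤ 60 * (n + 2) ∧ σ'.nat 5 = σ'.nat 4 + l ∧ σ'.nat 5 ≤ n ∧
      ∀ i, i + l ≤ n → P (i + l) - P i ≤ P (σ'.nat 5) - P (σ'.nat 4)) σ := by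
  simp only [bestStart, wp_seq, wp_setNat]
  refine (wp_while (fun σ => σ.nat 4 + l ≤ n ∧
    ∀ i < σ.nat 6, i + l ≤ n → P (i + l) - P i ≤ P (σ.nat 4 + l) - P (σ.nat 4))
    (fun σ => 50 * (n + 1 - σ.nat 6)) ?_ ?_).mono ?_
  · simpa using hl
  · intro σ₁ hF ⟨h4, hmax⟩ hlt
    have e0 : σ₁.nat 0 = n := (hF.nat 0 rfl).trans (by simpa using h.size)
    have e18 : σ₁.nat 18 = l := (hF.nat 18 rfl).trans (by simpa using h18)
    have eP : ∀ k ≤ n, σ₁.realArr 2 k = P k := fun k hk =>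
      (congrFun (hF.realArr 2 rfl) k).trans (by simpa using h.sums k hk)
    simp [e0, e18] at hlt
    simp [e18, eP _ hlt, eP _ h4, eP (σ₁.nat 6) (by omega), eP (σ₁.nat 4) (by omega),
      -tsub_le_iff_right]
    refine ⟨fun hle => ⟨⟨hlt, fun i hi hn => ?_⟩, by omega⟩,
      fun hlt' => ⟨⟨h4, fun i hi hn => ?_⟩, by omega⟩⟩
    · rcases hi.lt_or_eq with h' | rfl
      · exact (hmax i h' hn).trans hle
      · exact le_rfl
    · rcases hi.lt_or_eq with h' | rfl
      · exact hmax i h' hn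
      · exact hlt'.le
  · rintro t σ₁ ⟨hF, ⟨h4, hmax⟩, hlt, ht⟩
    have e0 : σ₁.nat 0 = n := (hF.nat 0 rfl).trans (by simpa using h.size)
    have e18 : σ₁.nat 18 = l := (hF.nat 18 rfl).trans (by simpa using h18)
    simp [e0, e18] at hlt
    simp [e18, -tsub_le_iff_right] at ht ⊢
    exact ⟨by omega, h4, fun i hi => hmax i (by omega) hi⟩

/-- Computes, in the integer registers `4` and `5`, an interval of largest eccentricity among those
of length between `L` and `2L - 1`. -/
def shortIntervals (M : Prog) : Prog :=
  .seq ceilSqrt <|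
  .seq (.setReal 5 (.add (.add (.reg 0) (.add (.reg 0) (.reg 0))) (.ofNat (.const 1)))) <|
  .seq (.setNat 18 (.reg 1)) <|
  .seq (.setReal 3 (.div (.sub (.get 2 (.reg 1)) (.get 2 (.const 0))) (.sqrt (.ofNat (.reg 1))))) <|
  .seq (processBlocks M) bestStart

theorem shortIntervals_spec {n L d : ℕ} {P : ℕ → ℝ} {T : ℕ → ℝ} {M : Prog}
    (hM : ComputesMinPlusProduct M T) {σ : State} (h : HoldsSums n L P σ) (hL : 1 ≤ L)
    (hLn : L ≤ n) (hd : ⌈Real.sqrt L⌉₊ = d) (hB : ∀ k ≤ n, |P k| ≤ σ.real 0) :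
    Wp (shortIntervals M) (fun t σ' =>
      t ≤ (n + d * d) / (d * d) *
        ((d * d + 2 * L + d) / d * (⌊T d⌋₊ + 250 * (d * d) + 70) + 40) + 300 * (n + 1) ∧
      σ'.nat 4 + L ≤ σ'.nat 5 ∧ σ'.nat 5 < σ'.nat 4 + 2 * L ∧ σ'.nat 5 ≤ n ∧
      ∀ a b, a + L ≤ b → b < a + 2 * L → b ≤ n →
        diffEcc P a b ≤ diffEcc P (σ'.nat 4) (σ'.nat 5)) σ := by
  have hd1 : 1 ≤ d := by
    rw [← hd]
    exact Nat.ceil_pos.2 (Real.sqrt_pos.2 (by exact_mod_cast hL))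
  simp only [shortIntervals, wp_seq, wp_setNat, wp_setReal]
  refine (ceilSqrt_spec h.bound).frame.mono ?_
  rintro t₁ σ₁ ⟨hF₁, ht₁, h10, h11, -⟩
  rw [hd] at h10
  rw [h10] at h11
  have hH₁ := h.frame hF₁ rfl rfl rfl
  have e0 : σ₁.real 0 = σ.real 0 := hF₁.real 0 rfl
  refine (processBlocks_spec (L := L) (B := σ.real 0) hM hd1 hB ⟨⟨?_, ?_, ?_⟩, ?_, ?_, ?_⟩
    ⟨?_, ?_, 0, ?_, ?_⟩).mono ?_
  · simp [hH₁.size]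
  · simp [hH₁.bound]
  · simpa using hH₁.sums
  · simp [h10]
  · simp [h11]
  · simp [e0]; ring
  · simp [hH₁.bound]
  · simp [hH₁.bound]; omega
  · simpa [hH₁.bound] using hLn
  · simp [hH₁.bound, diffEcc, hH₁.sums L hLn, hH₁.sums 0 (Nat.zero_le _)]
  rintro t₂ σ₂ ⟨ht₂, hH₂, hl₂, hall⟩
  obtain ⟨i₀, hi₀, hv⟩ := hl₂.value
  refine (bestStart_spec hH₂ rfl (by omega)).mono ?_
  rintro t₃ σ₃ ⟨ht₃, h5, h5n, hmax⟩
  have h1 := hl₂.le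
  have h2 := hl₂.lt
  refine ⟨?_, by omega, by omega, h5n, fun a b hab hb hbn => ?_⟩
  · simp only [NExpr.cost, RExpr.cost]
    omega
  · have h3 := hall a (b - a) (by omega) (by omega) (by omega)
    rw [Nat.add_sub_cancel' (by omega)] at h3
    refine h3.trans ?_
    rw [hv, diffEcc, diffEcc, h5, Nat.add_sub_cancel_left, Nat.add_sub_cancel_left, ← h5]
    exact div_le_div_of_nonneg_right (hmax i₀ hi₀) (Real.sqrt_nonneg _)

end PSEI

/-! ### The whole program -/

namespace PSEI

open RealRAM

theorem mem_longIntervals_iff {n L : ℕ} (hL : 1 ≤ L) {I : ℕ × ℕ} :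
    I ∈ longIntervals n L ↔ ∃ a b, a + L ≤ b ∧ b ≤ n ∧ I = (a + 1, b) := by
  constructor
  · obtain ⟨p, q⟩ := I
    rintro ⟨⟨h1, h2, h3⟩, h4⟩
    simp only [length] at *
    exact ⟨p - 1, q, by omega, h3, by rw [Nat.sub_add_cancel h1]⟩
  · rintro ⟨a, b, hab, hb, rfl⟩
    exact ⟨⟨by simp, by simp only; omega, hb⟩, by simp only [length]; omega⟩

theorem length_succ (a b : ℕ) : length (a + 1, b) = b - a := by simp [length]

theorem hit_div_sqrt (D : ℕ → ℝ × ℝ) {a b : ℕ} (h : a ≤ b) :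
    hit D (a + 1, b) / Real.sqrt (length (a + 1, b)) = diffEcc (prefixSum D) a b := by
  rw [hit_succ D h, length_succ, diffEcc]

section Results

variable {n L : ℕ} {D : ℕ → ℝ × ℝ} {i j i₀ j₀ : ℕ}

theorem isArgmax_hit (hL : 1 ≤ L) (hij : i + L ≤ j) (hj : j ≤ n)
    (h : ∀ a b, a + L ≤ b → b ≤ n →
      prefixSum D b - prefixSum D a ≤ prefixSum D j - prefixSum D i) :
    IsArgmax (hit D) (longIntervals n L) (i + 1, j) := by
  refine ⟨(mem_longIntervals_iff hL).2 ⟨i, j, hij, hj, rfl⟩, fun X hX => ?_⟩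
  obtain ⟨a, b, hab, hb, rfl⟩ := (mem_longIntervals_iff hL).1 hX
  rw [hit_succ D (by omega), hit_succ D (by omega)]
  exact h a b hab hb

theorem ComputePSEI.of_diffEcc_pos (hL : 1 ≤ L)
    (hI : IsArgmax (hit D) (longIntervals n L) (i₀ + 1, j₀)) (h0 : 0 < hit D (i₀ + 1, j₀))
    (hij : i + L ≤ j) (hj : j ≤ n)
    (h : ∀ a b, a + L ≤ b → b ≤ n →
      diffEcc (prefixSum D) a b ≤ diffEcc (prefixSum D) i j) :
    ComputePSEI n L D (i + 1, j) := by
  have hsqrt : ∀ {a b : ℕ}, a + L ≤ b → 0 < Real.sqrt (length (a + 1, b)) := fun {a b} hab =>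
    Real.sqrt_pos.2 (by rw [length_succ]; exact_mod_cast (by omega : 0 < b - a))
  have hpos : 0 < diffEcc (prefixSum D) i j := by
    obtain ⟨a, b, hab, hb, he⟩ := (mem_longIntervals_iff hL).1 hI.1
    refine lt_of_lt_of_le ?_ (h a b hab hb)
    rw [← hit_div_sqrt D (by omega), ← he]
    exact div_pos h0 (he ▸ hsqrt hab)
  have hhit : 0 < hit D (i + 1, j) := by
    rw [← hit_div_sqrt D (by omega)] at hpos
    by_contra! hcon
    exact absurd hpos (not_lt.2 (div_nonpos_of_nonpos_of_nonneg hcon (Real.sqrt_nonneg _)))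
  refine .pos _ _ hI h0 ⟨(mem_longIntervals_iff hL).2 ⟨i, j, hij, hj, rfl⟩, fun X hX => ?_⟩
  obtain ⟨a, b, hab, hb, rfl⟩ := (mem_longIntervals_iff hL).1 hX
  simp only [score, if_pos hhit.le]
  rw [hit_div_sqrt D (by omega : i ≤ j), hit_div_sqrt D (by omega : a ≤ b)]
  split_ifs
  · exact h a b hab hb
  · exact hpos.le

theorem ComputePSEI.of_diffEcc_neg (hD : Plain n D) (hL : 1 ≤ L) (hLn : L ≤ n)
    (hI : IsArgmax (hit D) (longIntervals n L) (i₀ + 1, j₀)) (h0 : hit D (i₀ + 1, j₀) < 0)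
    (hij : i + L ≤ j) (hlt : j < i + 2 * L) (hj : j ≤ n)
    (h : ∀ a b, a + L ≤ b → b < a + 2 * L → b ≤ n →
      diffEcc (prefixSum D) a b ≤ diffEcc (prefixSum D) i j) :
    ComputePSEI n L D (i + 1, j) := by
  have hmem : (i + 1, j) ∈ longIntervals n L := (mem_longIntervals_iff hL).2 ⟨i, j, hij, hj, rfl⟩
  refine .of_isArgmax_ecc hD hL hLn hI h0 ⟨hmem, fun X hX => ?_⟩ (by rw [length_succ]; omega)
  obtain ⟨Y, hY, hYl, hXY⟩ := exists_short hL (fun J hJ => (hI.2 J hJ).trans_lt h0) hX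
  obtain ⟨a, b, hab, hb, rfl⟩ := (mem_longIntervals_iff hL).1 hY
  rw [length_succ] at hYl
  rw [ecc_eq hD hX.1, ecc_eq hD hmem.1, hit_div_sqrt D (by omega : i ≤ j)]
  rw [hit_div_sqrt D (by omega : a ≤ b)] at hXY
  exact hXY.trans (h a b hab (by omega) hb)

end Results

/-- Algorithm ComputePSEI, with a program `M` for min-plus products. The registers `4` and `5` hold
`i` and `j` for an interval `[i + 1, j]`: first the one of largest hit-support, and in the end the
one to be returned. -/
def computePSEI (M : Prog) : Prog :=
  .seq prefixSums <|
  .seq maxDiff <|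
  .seq (.ite (.realLe (.ofNat (.const 0)) (.sub (.get 2 (.reg 5)) (.get 2 (.reg 4))))
    (.ite (.realLe (.sub (.get 2 (.reg 5)) (.get 2 (.reg 4))) (.ofNat (.const 0)))
      .skip (.seq rightSlopes scanHulls))
    (shortIntervals M)) <|
  .seq (.setNat 0 (.add (.reg 4) (.const 1))) (.setNat 1 (.reg 5))

theorem computePSEI_spec {n L d : ℕ} {D : ℕ → ℝ × ℝ} {T : ℕ → ℝ} {M : Prog}
    (hM : ComputesMinPlusProduct M T) (hD : Plain n D) (hL : 1 ≤ L) (hLn : L ≤ n)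
    (hd : ⌈Real.sqrt L⌉₊ = d) {σ : State} (hσ : HoldsInput n L D σ) :
    Wp (computePSEI M) (fun t σ' =>
      t ≤ (n + d * d) / (d * d) *
        ((d * d + 2 * L + d) / d * (⌊T d⌋₊ + 250 * (d * d) + 70) + 40) + 1300 * (n + 1) ∧
      ComputePSEI n L D (σ'.nat 0, σ'.nat 1)) σ := by
  simp only [computePSEI, wp_seq]
  refine (prefixSums_spec hσ).mono ?_
  rintro t₁ σ₁ ⟨ht₁, hH₁, hB₁⟩
  refine (maxDiff_spec hH₁ hLn).frame.mono ?_
  rintro t₂ σ₂ ⟨hF₂, ht₂, hij, hj, hmax⟩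
  have hH₂ := hH₁.frame hF₂ rfl rfl rfl
  have e0 : σ₂.real 0 = σ₁.real 0 := hF₂.real 0 rfl
  have hI := isArgmax_hit hL hij hj hmax
  have hhit : hit D (σ₂.nat 4 + 1, σ₂.nat 5) = prefixSum D (σ₂.nat 5) - prefixSum D (σ₂.nat 4) :=
    hit_succ D (by omega)
  have e4 := hH₂.sums (σ₂.nat 4) (by omega)
  have e5 := hH₂.sums (σ₂.nat 5) hj
  rw [wp_ite]
  simp only [BExpr.holds, RExpr.eval, NExpr.eval, e4, e5, ← hhit, Nat.cast_zero, not_le]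
  constructor
  · intro hnonneg
    rw [wp_ite]
    simp only [BExpr.holds, RExpr.eval, NExpr.eval, e4, e5, ← hhit, Nat.cast_zero, not_le]
    constructor
    · intro hnonpos
      simp
      exact ⟨by omega, .zero _ hI (le_antisymm hnonpos hnonneg)⟩
    · intro hpos
      rw [wp_seq]
      refine (rightSlopes_spec hH₂).frame.mono ?_
      rintro t₃ σ₃ ⟨hF₃, ht₃, hr⟩
      have hH₃ := hH₂.frame hF₃ rfl rfl rfl
      have f4 : σ₃.nat 4 = σ₂.nat 4 := hF₃.nat 4 rfl
      have f5 : σ₃.nat 5 = σ₂.nat 5 := hF₃.nat 5 rfl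
      refine (scanHulls_spec hH₃ hL (by omega) (by omega) (by rw [f4, f5, ← hhit]; exact hpos)
        hr).mono ?_
      rintro t₄ σ₄ ⟨ht₄, hij₄, hj₄, hopt⟩
      simp
      exact ⟨by omega, .of_diffEcc_pos hL hI hpos hij₄ hj₄ hopt⟩
  · intro hneg
    refine (shortIntervals_spec hM hH₂ hL hLn hd (by rwa [e0])).mono ?_
    rintro t₃ σ₃ ⟨ht₃, hij₃, hlt₃, hj₃, hopt⟩
    simp only [wp_setNat, BExpr.cost, RExpr.cost, NExpr.cost]
    refine ⟨by omega, ?_⟩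
    simpa using ComputePSEI.of_diffEcc_neg hD hL hLn hI hneg hij₃ hlt₃ hj₃ hopt

/-- There are `O(n / L)` blocks of `d ^ 2` positions and `O(d)` min-plus products for each block,
where `d = ⌈√L⌉`. As `T d ≥ d ^ 2`, the time for the other steps is also within the bound. -/
theorem time_bound {n L d : ℕ} {T : ℕ → ℝ} (hL : 1 ≤ L) (hLn : L ≤ n)
    (hd : ⌈Real.sqrt L⌉₊ = d) (hT : (d : ℝ) ^ 2 ≤ T d) {t : ℕ}
    (ht : t ≤ (n + d * d) / (d * d) *
      ((d * d + 2 * L + d) / d * (⌊T d⌋₊ + 250 * (d * d) + 70) + 40) + 1300 * (n + 1)) :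
    (t : ℝ) ≤ 8000 * (n * (T d / Real.sqrt L)) := by
  set q := Real.sqrt L with hq
  have hL' : (1 : ℝ) ≤ L := by exact_mod_cast hL
  have hLn' : (L : ℝ) ≤ n := by exact_mod_cast hLn
  have hq1 : 1 ≤ q := Real.one_le_sqrt.2 hL'
  have hqq : q * q = L := Real.mul_self_sqrt (by linarith)
  have hqd : q ≤ d := hd ▸ Nat.le_ceil _
  have hd1 : (1 : ℝ) ≤ d := hq1.trans hqd
  have hdq : (d : ℝ) ≤ 2 * q := by
    have := Nat.ceil_lt_add_one (Real.sqrt_nonneg (L : ℝ))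
    rw [hd] at this
    linarith
  have hLd : (L : ℝ) ≤ d * d := by nlinarith
  rw [sq] at hT
  have hT1 : 1 ≤ T d := by nlinarith
  have h₁ : (((n + d * d) / (d * d) : ℕ) : ℝ) ≤ 2 * (n / L) := by
    refine Nat.cast_div_le.trans ?_
    push_cast
    rw [add_div, div_self (by positivity)]
    have : (n : ℝ) / (d * d) ≤ n / L := by gcongr
    have : 1 ≤ (n : ℝ) / L := (one_le_div (by linarith)).2 hLn'
    linarith
  have h₂ : (((d * d + 2 * L + d) / d : ℕ) : ℝ) ≤ 4 * d := by
    refine Nat.cast_div_le.trans ?_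
    push_cast
    rw [div_le_iff₀ (by linarith)]
    nlinarith
  have h₃ : (⌊T d⌋₊ : ℝ) ≤ T d := Nat.floor_le (by linarith)
  have h₄ : (t : ℝ) ≤ (((n + d * d) / (d * d) : ℕ) : ℝ) *
      ((((d * d + 2 * L + d) / d : ℕ) : ℝ) * (⌊T d⌋₊ + 250 * (d * d) + 70) + 40) +
        1300 * (n + 1) := by exact_mod_cast ht
  have h₅ : (((d * d + 2 * L + d) / d : ℕ) : ℝ) * (⌊T d⌋₊ + 250 * (d * d) + 70) + 40 ≤
      1324 * (2 * q) * T d := by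
    have : (((d * d + 2 * L + d) / d : ℕ) : ℝ) * (⌊T d⌋₊ + 250 * (d * d) + 70) ≤
        4 * d * (321 * T d) := by
      gcongr
      linarith
    have h6 : 1 ≤ d * T d := one_le_mul_of_one_le_of_one_le hd1 hT1
    have h7 : d * T d ≤ 2 * q * T d := by gcongr
    linarith
  have h₆ : (1 : ℝ) ≤ T d / q := (one_le_div (by linarith)).2 (by nlinarith)
  have h₇ : (((n + d * d) / (d * d) : ℕ) : ℝ) *
      ((((d * d + 2 * L + d) / d : ℕ) : ℝ) * (⌊T d⌋₊ + 250 * (d * d) + 70) + 40) ≤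
      5296 * (n * (T d / q)) := by
    calc _ ≤ 2 * ((n : ℝ) / L) * (1324 * (2 * q) * T d) := by gcongr
      _ = 5296 * (n * (T d / q)) := by
        rw [← hqq]
        field_simp
        ring
  have h₈ : (n : ℝ) ≤ n * (T d / q) := le_mul_of_one_le_right (by linarith) h₆
  linarith

end PSEI

theorem mainTheorem4 :
    -- Correctness: every interval that the algorithm may return is an optimal one.
    (∀ (n L : ℕ) (D : ℕ → ℝ × ℝ), PSEI.Plain n D → 1 ≤ L → L ≤ n →
      ∀ I : ℕ × ℕ, PSEI.ComputePSEI n L D I → PSEI.IsSolution n L D I) ∧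
    -- Running time: the algorithm can be carried out in time `O(n T(√L) / √L)`.
    ∃ K : ℝ, ∀ (T : ℕ → ℝ) (M : RealRAM.Prog), ComputesMinPlusProduct M T →
      ∃ P : RealRAM.Prog,
        ∀ (n L : ℕ) (D : ℕ → ℝ × ℝ), PSEI.Plain n D → 1 ≤ L → L ≤ n →
          ∀ σ : RealRAM.State, PSEI.HoldsInput n L D σ →
            ∃ (t : ℕ) (σ' : RealRAM.State), RealRAM.Run P σ t σ' ∧
              (t : ℝ) ≤ K * (n * (T ⌈Real.sqrt L⌉₊ / Real.sqrt L)) ∧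
              PSEI.ComputePSEI n L D (σ'.nat 0, σ'.nat 1) := by
  refine ⟨fun n L D hD hL _ I hI => hI.isSolution hD hL, 8000, fun T M hM =>
    ⟨PSEI.computePSEI M, fun n L D hD hL hLn σ hσ => ?_⟩⟩
  obtain ⟨t, σ', hr, ht, hres⟩ := PSEI.computePSEI_spec hM hD hL hLn rfl hσ
  refine ⟨t, σ', hr, PSEI.time_bound hL hLn rfl (hM.sq_le ?_) ht, hres⟩
  exact Nat.ceil_pos.2 (Real.sqrt_pos.2 (by exact_mod_cast hL))
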